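/- Let $\gamma\ge 2$ and let $\Sigma$ be a closed connected orientable smooth surface of genus $\gamma$, with a smooth Riemannian metric $g_\Sigma$ of constant sectional curvature $-1$. Let $g_{S^2}$ be the round metric of constant curvature $+1$ on the unit sphere $S^2$, and let $g=g_{S^2}+g_\Sigma$ be the product metric on $M=S^2\times\Sigma$ (where $g_{S^2}$ and $g_\Sigma$ also denote the pullbacks to $M$ by the two projections). Then: 1. $(M,g)$ is locally conformally flat: every point of $M$ has an open neighbourhood $U$ with a smooth function $f>0$ on $U$ such that $fg$ has zero sectional curvature everywhere on $U$. 2. $M$ is orientable and, for every orientation of $M$, $(M,g)$ is self-dual, i.e. $W_-\equiv 0$, where $W_-:\Lambda^2_-\to\Lambda^2_-$ is the component of the Weyl tensor, acting as an operator on $2$-forms, on the $(-1)$-eigenspace $\Lambda^2_-$ of the Hodge star. 3. The Riemann curvature $(0,4)$-tensor of $g$ is $\mathrm{Rm}=g\odot\tfrac12(g_{S^2}-g_\Sigma)$, where $(A\odot B)(X,Y,Z,T)=A(X,Z)B(Y,T)-B(X,T)A(Y,Z)+B(X,Z)A(Y,T)-A(X,T)B(Y,Z)$ is the Kulkarni–Nomizu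 product, and $\mathrm{Rm}$ has the sign for which a metric of constant curvature $k$ has $\mathrm{Rm}=\tfrac k2\,g\odot g$. 4. The Weyl tensor $W=\mathrm{Rm}-\tfrac{s}{2n(n-1)}\,g\odot g-\tfrac1{n-2}\bigl(\mathrm{Ric}-\tfrac sn g\bigr)\odot g$, $n=4$ (with $\mathrm{Ric}$ the Ricci tensor and $s$ the scalar curvature of $g$), vanishes identically. -/

import Mathlib

open scoped Manifold ContDiff Topology Bundle

noncomputable section

namespace RiemGeom

/-! ### Pointwise algebra: tensors on a real vector space `V` with a scalar product `g` -/

section Algebra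

variable {V : Type*} [AddCommGroup V] [Module ℝ V] [Module.Finite ℝ V]

/-- The Kulkarni–Nomizu product of two symmetric `2`-tensors,
`(A ∧ B)(X,Y,Z,T) = det [A(X,Z), B(X,T); A(Y,Z), B(Y,T)] + det [B(X,Z), A(X,T); B(Y,Z), A(Y,T)]`. -/
def kulkarniNomizu (A B : V → V → ℝ) (X Y Z T : V) : ℝ :=
  Matrix.det !![A X Z, B X T; A Y Z, B Y T] + Matrix.det !![B X Z, A X T; B Y Z, A Y T]

/-- The sectional curvature of the plane spanned by `X, Y`, for the `(0,4)` curvature tensor `R`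
(with the sign convention that `R X Y X Y` is positive on the round sphere). -/
def sectional (g : V → V → ℝ) (R : V → V → V → V → ℝ) (X Y : V) : ℝ :=
  R X Y X Y / (g X X * g Y Y - g X Y ^ 2)

/-- The metric trace `∑ gⁱʲ B(eᵢ, eⱼ)` of a bilinear form `B` on a finite-dimensional space, where
`e` is a basis and `gⁱʲ` is the inverse of the Gram matrix `g(eᵢ, eⱼ)`.
(For bilinear `B` it does not depend on the basis.) -/
def metricTrace (g B : V → V → ℝ) : ℝ :=
  ∑ i, ∑ j,
    (Matrix.of fun k l => g (Module.finBasis ℝ V k) (Module.finBasis ℝ V l))⁻¹ i j *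
      B (Module.finBasis ℝ V i) (Module.finBasis ℝ V j)

/-- The Ricci contraction `Ric(Y,T) = tr_g R(·,Y,·,T)`. -/
def ricci (g : V → V → ℝ) (R : V → V → V → V → ℝ) (Y T : V) : ℝ :=
  metricTrace g fun X Z => R X Y Z T

/-- The scalar curvature `tr_g Ric`. -/
def scalar (g : V → V → ℝ) (R : V → V → V → V → ℝ) : ℝ :=
  metricTrace g (ricci g R)

/-- The Weyl part `W = R - U - Z` of a curvature tensor, where, in dimension `n`,
`U = s / (2n(n-1)) g ∧ g` and `Z = 1/(n-2) (Ric - (s/n) g) ∧ g`. -/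
def weylPart (g : V → V → ℝ) (R : V → V → V → V → ℝ) (X Y Z T : V) : ℝ :=
  let n : ℝ := Module.finrank ℝ V
  let s : ℝ := scalar g R
  R X Y Z T - s / (2 * n * (n - 1)) * kulkarniNomizu g g X Y Z T
    - 1 / (n - 2) * kulkarniNomizu (fun v w => ricci g R v w - s / n * g v w) g X Y Z T

/-- The scalar product of two `2`-forms,
`⟨α, β⟩ = ½ ∑ gⁱᵏ gʲˡ αᵢⱼ βₖₗ`, for which `eⁱ ∧ eʲ`, `i < j`, is orthonormal if `e` is. -/
def innerTwo (g α β : V → V → ℝ) : ℝ :=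
  1 / 2 * metricTrace g fun X X' => metricTrace g fun Y Y' => α X Y * β X' Y'

/-- The `2`-form `Wβ` obtained by letting a curvature-like tensor `W` act as an operator on
`2`-forms, `(Wβ)(X,Y) = ½ ∑ gᵏᵖ gˡʳ W(X,Y,eₖ,eₗ) β(eₚ,eᵣ)`. -/
def actTwo (g : V → V → ℝ) (W : V → V → V → V → ℝ) (β : V → V → ℝ) (X Y : V) : ℝ :=
  innerTwo g (W X Y) β

/-- The value `(α ∧ β)(v₀, v₁, v₂, v₃)` of the exterior product of two `2`-forms. -/
def wedgeTwo (α β : V → V → ℝ) (v : Fin 4 → V) : ℝ :=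
  α (v 0) (v 1) * β (v 2) (v 3) - α (v 0) (v 2) * β (v 1) (v 3) + α (v 0) (v 3) * β (v 1) (v 2)
    + α (v 1) (v 2) * β (v 0) (v 3) - α (v 1) (v 3) * β (v 0) (v 2) + α (v 2) (v 3) * β (v 0) (v 1)

/-- An alternating `2`-form as a function of two vectors. -/
def toTwo (α : V [⋀^Fin 2]→ₗ[ℝ] ℝ) (X Y : V) : ℝ := α ![X, Y]

/-- `vol` is the volume form of `g` and the orientation `o`: it takes the value `1` on every
positively oriented `g`-orthonormal basis. -/
def IsVolumeForm (g : V → V → ℝ) (o : Orientation ℝ V (Fin 4)) (vol : V [⋀^Fin 4]→ₗ[ℝ] ℝ) :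
    Prop :=
  ∀ e : Module.Basis (Fin 4) ℝ V, (∀ i j, g (e i) (e j) = if i = j then 1 else 0) →
    e.orientation = o → vol e = 1

/-- `γ = ⋆β`, that is, `α ∧ γ = ⟨α, β⟩ vol` for all `2`-forms `α`. -/
def IsHodgeStar (g : V → V → ℝ) (o : Orientation ℝ V (Fin 4)) (β γ : V [⋀^Fin 2]→ₗ[ℝ] ℝ) : Prop :=
  ∀ vol : V [⋀^Fin 4]→ₗ[ℝ] ℝ, IsVolumeForm g o vol →
    ∀ (α : V [⋀^Fin 2]→ₗ[ℝ] ℝ) (v : Fin 4 → V),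
      wedgeTwo (toTwo α) (toTwo γ) v = innerTwo g (toTwo α) (toTwo β) * vol v

/-- The component `W₋ : Λ²₋ → Λ²₋` of a curvature-like tensor `W` on an oriented four-dimensional
space vanishes, where `Λ²₋ = {β | ⋆β = -β}`: all matrix entries `⟨Wβ, γ⟩`, `β, γ ∈ Λ²₋`,
are zero. -/
def AntiSelfDualPartVanishes (g : V → V → ℝ) (o : Orientation ℝ V (Fin 4))
    (W : V → V → V → V → ℝ) : Prop :=
  ∀ β γ : V [⋀^Fin 2]→ₗ[ℝ] ℝ, IsHodgeStar g o β (-β) → IsHodgeStar g o γ (-γ) →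
    innerTwo g (actTwo g W (toTwo β)) (toTwo γ) = 0

end Algebra

/-! ### Curvature of a metric on (an open subset of) a normed space `E` -/

section Coordinates

variable {E : Type*} [NormedAddCommGroup E] [NormedSpace ℝ E]

/-- The Christoffel symbols of the first kind,
`Γ(u,v;w) = ½ (∂ᵤ G(v,w) + ∂ᵥ G(u,w) - ∂_w G(u,v))`, as a continuous linear form in `w`. -/
def christoffelFirst (G : E → E →L[ℝ] E →L[ℝ] ℝ) (x u v : E) : E →L[ℝ] ℝ :=
  (1 / 2 : ℝ) • (fderiv ℝ G x u v + fderiv ℝ G x v u - ((fderiv ℝ G x).flip u).flip v)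

/-- The Christoffel symbols of the second kind, `G(Γ(u,v), w) = Γ(u,v;w)` for all `w`. -/
def christoffel (G : E → E →L[ℝ] E →L[ℝ] ℝ) (x u v : E) : E :=
  (G x).inverse (christoffelFirst G x u v)

/-- The curvature operator on constant vector fields,
`R(u,v)w = ∂ᵤ(Γ(v,w)) - ∂ᵥ(Γ(u,w)) + Γ(u,Γ(v,w)) - Γ(v,Γ(u,w))`,
i.e. `R(u,v) = ∇ᵤ∇ᵥ - ∇ᵥ∇ᵤ` for the Levi-Civita connection `∇ᵤw = ∂ᵤw + Γ(u,w)`. -/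
def coordCurvature (G : E → E →L[ℝ] E →L[ℝ] ℝ) (x u v w : E) : E :=
  fderiv ℝ (fun y => christoffel G y v w) x u - fderiv ℝ (fun y => christoffel G y u w) x v
    + christoffel G x u (christoffel G x v w) - christoffel G x v (christoffel G x u w)

end Coordinates

/-! ### Riemannian geometry of a manifold without boundary -/

section Manifold

variable {E : Type*} [NormedAddCommGroup E] [NormedSpace ℝ E] {H : Type*} [TopologicalSpace H]
  (I : ModelWithCorners ℝ E H) (M : Type*) [TopologicalSpace M] [ChartedSpace H M]
  {F : Type*} [NormedAddCommGroup F] [NormedSpace ℝ F] {K : Type*} [TopologicalSpace K]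
  (J : ModelWithCorners ℝ F K) {N : Type*} [TopologicalSpace N] [ChartedSpace K N]

/-- A field of bilinear forms on the tangent spaces of `M`, such as the field `g.inner` of a
Riemannian metric `g`. -/
abbrev FormField : Type _ := ∀ x : M, TangentSpace I x →L[ℝ] TangentSpace I x →L[ℝ] ℝ

variable {M}

/-- The pullback `(f^*h)ₓ(v,w) = h_{f x}(dfₓ v, dfₓ w)`. -/
def pullback (f : M → N) (h : FormField J N) : FormField I M := fun x =>
  ContinuousLinearMap.bilinearComp (E := F) (F := F) (E' := E) (F' := E)
    (h (f x)) (mfderiv I J f x) (mfderiv I J f x)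

/-- The metric `g` written in the preferred chart at `p`, a field of bilinear forms on the model
vector space `E`. -/
def chartForm (g : FormField I M) (p : M) : E → E →L[ℝ] E →L[ℝ] ℝ :=
  pullback 𝓘(ℝ, E) I (extChartAt I p).symm g

/-- The Riemann curvature tensor `Rm(X,Y,Z,T) = g(R(X,Y)T, Z)` at `p`, computed in the preferred
chart at `p`; this is the chart through which Mathlib identifies the tangent space at `p` with `E`.
With this convention a metric of constant curvature `k` has `Rm = (k/2) g ∧ g`. -/
def curvature (g : FormField I M) (p : M) (X Y Z T : TangentSpace I p) : ℝ :=
  g p (coordCurvature (chartForm I g p) (extChartAt I p p) X Y T : E) Z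

instance [FiniteDimensional ℝ E] (p : M) : Module.Finite ℝ (TangentSpace I p) :=
  inferInstanceAs (Module.Finite ℝ E)

/-- The Weyl tensor of `g` at `p`. -/
def weyl [FiniteDimensional ℝ E] (g : FormField I M) (p : M) :
    TangentSpace I p → TangentSpace I p → TangentSpace I p → TangentSpace I p → ℝ :=
  weylPart (fun X Y => g p X Y) (curvature I g p)

/-- `g` has sectional curvature constantly equal to `k` on the subset `U`. -/
def HasConstCurvOn (g : FormField I M) (k : ℝ) (U : Set M) : Prop :=
  ∀ p ∈ U, ∀ X Y : TangentSpace I p, LinearIndependent ℝ ![X, Y] →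
    sectional (fun X Y => g p X Y) (curvature I g p) X Y = k

/-- `(M, g)` is locally conformally flat: on a neighbourhood `U` of any point there is a positive
smooth function `f` such that `f g` has zero sectional curvature everywhere on `U`. -/
def IsLocallyConformallyFlat (g : FormField I M) : Prop :=
  ∀ p : M, ∃ U : Set M, IsOpen U ∧ p ∈ U ∧ ∃ f : M → ℝ,
    ContMDiffOn I 𝓘(ℝ, ℝ) ∞ f U ∧ (∀ x ∈ U, 0 < f x) ∧ HasConstCurvOn I (fun x => f x • g x) 0 U

variable (M) in
/-- An orientation of an `n`-manifold: a choice of an orientation of each tangent space that is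
locally constant, i.e. for `q` near `p` the differentials of the preferred chart at `p` carry
the orientations at `q` and at `p` to the same orientation of `E`. -/
structure ManifoldOrientation (n : ℕ) where
  /-- The orientation of the tangent space at a point. -/
  at_ (p : M) : Orientation ℝ (TangentSpace I p) (Fin n)
  locallyConstant (p : M) : ∀ᶠ q in 𝓝 p,
    ∀ (b : Module.Basis (Fin n) ℝ (TangentSpace I q))
      (c : Module.Basis (Fin n) ℝ (TangentSpace I p)),
      (∀ i, (mfderiv I 𝓘(ℝ, E) (extChartAt I p) q (b i) : E) =
        (mfderiv I 𝓘(ℝ, E) (extChartAt I p) p (c i) : E)) →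
      (b.orientation = at_ q ↔ c.orientation = at_ p)

variable {I} in
/-- The oriented Riemannian `4`-manifold `(M, g, o)` is self-dual: `W₋ ≡ 0`. -/
def IsSelfDual [FiniteDimensional ℝ E] (g : FormField I M) (o : ManifoldOrientation I M 4) : Prop :=
  ∀ p : M, AntiSelfDualPartVanishes (fun X Y => g p X Y) (o.at_ p) (weyl I g p)

end Manifold

/-! ### The round sphere, surfaces of genus `γ`, products -/

/-- The unit sphere `S²` in Euclidean `3`-space. -/
abbrev S2 : Type := Metric.sphere (0 : EuclideanSpace ℝ (Fin 3)) 1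

/-- The round metric on `S²`: the restriction of the Euclidean scalar product. -/
def roundMetric : FormField (𝓡 2) S2 :=
  pullback (𝓡 2) 𝓘(ℝ, EuclideanSpace ℝ (Fin 3)) (Subtype.val : S2 → EuclideanSpace ℝ (Fin 3))
    (fun _ => (innerSL ℝ : EuclideanSpace ℝ (Fin 3) →L[ℝ] EuclideanSpace ℝ (Fin 3) →L[ℝ] ℝ))

universe u in
/-- The first Betti number `b₁(X) = dim H₁(X; ℚ)` (singular homology). -/
def bettiOne (X : Type u) [TopologicalSpace X] : ℕ :=
  Module.finrank ℚ
    (((AlgebraicTopology.singularHomologyFunctor (ModuleCat.{u} ℚ) 1).obj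
      (ModuleCat.of ℚ (ULift.{u} ℚ))).obj (TopCat.of X))

/-- `S` is a closed (compact, connected, Hausdorff, without boundary), orientable smooth surface
of genus `γ`, where the genus is half of the first Betti number. -/
structure IsClosedOrientableSurface (S : Type*) [TopologicalSpace S]
    [ChartedSpace (EuclideanSpace ℝ (Fin 2)) S] [IsManifold (𝓡 2) ∞ S] (γ : ℕ) : Prop where
  compact : CompactSpace S
  t2 : T2Space S
  connected : ConnectedSpace S
  orientable : Nonempty (ManifoldOrientation (𝓡 2) S 2)
  genus : bettiOne S = 2 * γ

section Product

variable {S : Type*} [TopologicalSpace S] [ChartedSpace (EuclideanSpace ℝ (Fin 2)) S]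

/-- The metric of `S²` as a symmetric `2`-tensor on `S² × S` (pulled back by the projection). -/
def sphereTensor : FormField ((𝓡 2).prod (𝓡 2)) (S2 × S) :=
  pullback ((𝓡 2).prod (𝓡 2)) (𝓡 2) Prod.fst roundMetric

/-- A metric of `S` as a symmetric `2`-tensor on `S² × S` (pulled back by the projection). -/
def surfaceTensor (h : FormField (𝓡 2) S) : FormField ((𝓡 2).prod (𝓡 2)) (S2 × S) :=
  pullback ((𝓡 2).prod (𝓡 2)) (𝓡 2) Prod.snd h

/-- The product metric on `S² × S` of the round metric of `S²` and the metric `h` of `S`. -/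
def productMetric (h : FormField (𝓡 2) S) : FormField ((𝓡 2).prod (𝓡 2)) (S2 × S) :=
  fun p => sphereTensor p + surfaceTensor h p

end Product

end RiemGeom

end

noncomputable section

namespace RiemGeom

open Filter Set

set_option maxSynthPendingDepth 3

local notation "E2" => EuclideanSpace ℝ (Fin 2)
local notation "E3" => EuclideanSpace ℝ (Fin 3)

section Coordinates

variable {E : Type*} [NormedAddCommGroup E] [NormedSpace ℝ E]
  {F : Type*} [NormedAddCommGroup F] [NormedSpace ℝ F]

/-- `G` is smooth at `x` and `G x` is a symmetric nondegenerate bilinear form. -/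
structure IsMetricAt (G : E → E →L[ℝ] E →L[ℝ] ℝ) (x : E) : Prop where
  smooth : ContDiffAt ℝ ∞ G x
  symm : ∀ u v, G x u v = G x v u
  inv : (G x).IsInvertible

/-- The Christoffel symbols as a field of continuous bilinear maps. -/
def christoffelCLM (G : E → E →L[ℝ] E →L[ℝ] ℝ) (x : E) : E →L[ℝ] E →L[ℝ] E :=
  (ContinuousLinearMap.compL ℝ E (E →L[ℝ] ℝ) E (G x).inverse).comp
    ((1 / 2 : ℝ) • (fderiv ℝ G x + (fderiv ℝ G x).flip -
      ((ContinuousLinearMap.flipₗᵢ ℝ E E ℝ).toContinuousLinearEquiv : (E →L[ℝ] E →L[ℝ] ℝ) →L[ℝ] _).comp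
        (fderiv ℝ G x).flip))

theorem christoffelCLM_apply (G : E → E →L[ℝ] E →L[ℝ] ℝ) (x u v : E) :
    christoffelCLM G x u v = christoffel G x u v := by
  simp [christoffelCLM, christoffel, christoffelFirst]

theorem contDiffAt_fderiv_top {Φ : E → F} {x : E} (h : ContDiffAt ℝ ∞ Φ x) :
    ContDiffAt ℝ ∞ (fderiv ℝ Φ) x :=
  h.fderiv_right (by simp)

theorem contDiffAt_christoffelCLM [CompleteSpace E] {G : E → E →L[ℝ] E →L[ℝ] ℝ} {x : E}
    (h : IsMetricAt G x) : ContDiffAt ℝ ∞ (christoffelCLM G) x := by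
  have h1 : ContDiffAt ℝ ∞ (fderiv ℝ G) x := contDiffAt_fderiv_top h.smooth
  have h2 : ContDiffAt ℝ ∞ (fun y => (G y).inverse) x :=
    h.inv.contDiffAt_map_inverse.comp x h.smooth
  have h3 : ContDiffAt ℝ ∞ (fun y => (fderiv ℝ G y).flip) x :=
    (ContinuousLinearMap.flipₗᵢ ℝ E E (E →L[ℝ] ℝ)).contDiff.contDiffAt.comp x h1
  refine ContDiffAt.clm_comp ((ContinuousLinearMap.contDiff _).contDiffAt.comp x h2) ?_
  exact (contDiffAt_const (c := (1 / 2 : ℝ))).smul ((h1.add h3).sub (contDiffAt_const.clm_comp h3))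

theorem coordCurvature_eq {G : E → E →L[ℝ] E →L[ℝ] ℝ} {x : E}
    (h : DifferentiableAt ℝ (christoffelCLM G) x) (u v w : E) :
    coordCurvature G x u v w =
      fderiv ℝ (christoffelCLM G) x u v w - fderiv ℝ (christoffelCLM G) x v u w +
        christoffelCLM G x u (christoffelCLM G x v w) -
        christoffelCLM G x v (christoffelCLM G x u w) := by
  have key (a b c : E) : fderiv ℝ (fun y => christoffel G y a b) x c =
      fderiv ℝ (christoffelCLM G) x c a b := by
    simp_rw [← christoffelCLM_apply]
    rw [((h.hasFDerivAt.clm_apply (hasFDerivAt_const a x)).clm_apply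
      (hasFDerivAt_const b x)).fderiv]
    simp
  simp only [coordCurvature, key, christoffelCLM_apply]

theorem fderiv_form_symm {G : E → E →L[ℝ] E →L[ℝ] ℝ} {x : E}
    (h : ∀ᶠ y in 𝓝 x, IsMetricAt G y) (u v w : E) :
    fderiv ℝ G x u v w = fderiv ℝ G x u w v := by
  have hd := (h.self_of_nhds.smooth.differentiableAt (by simp)).hasFDerivAt
  have key (a b : E) : fderiv ℝ (fun y => G y a b) x u = fderiv ℝ G x u a b := by
    rw [((hd.clm_apply (hasFDerivAt_const a x)).clm_apply (hasFDerivAt_const b x)).fderiv]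
    simp
  rw [← key, ← key]
  congr 1
  exact Filter.EventuallyEq.fderiv_eq (h.mono fun y hy => hy.symm v w)

theorem form_christoffel {G : E → E →L[ℝ] E →L[ℝ] ℝ} {x : E} (h : (G x).IsInvertible)
    (u v w : E) : G x (christoffelCLM G x u v) w =
      1 / 2 * (fderiv ℝ G x u v w + fderiv ℝ G x v u w - fderiv ℝ G x w u v) := by
  rw [christoffelCLM_apply, christoffel, h.self_apply_inverse]
  simp [christoffelFirst]

theorem christoffel_eq_of_forall {G : E → E →L[ℝ] E →L[ℝ] ℝ} {x : E} (h : (G x).IsInvertible)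
    {u v z : E} (hz : ∀ w, G x z w =
      1 / 2 * (fderiv ℝ G x u v w + fderiv ℝ G x v u w - fderiv ℝ G x w u v)) :
    christoffelCLM G x u v = z :=
  h.injective (ContinuousLinearMap.ext fun w => by rw [form_christoffel h, hz])

theorem christoffel_symm {G : E → E →L[ℝ] E →L[ℝ] ℝ} {x : E}
    (h : ∀ᶠ y in 𝓝 x, IsMetricAt G y) (u v : E) :
    christoffelCLM G x u v = christoffelCLM G x v u := by
  refine christoffel_eq_of_forall h.self_of_nhds.inv fun w => ?_
  rw [form_christoffel h.self_of_nhds.inv, fderiv_form_symm h w u v]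
  ring

theorem fderiv_form {G : E → E →L[ℝ] E →L[ℝ] ℝ} {x : E}
    (h : ∀ᶠ y in 𝓝 x, IsMetricAt G y) (u v w : E) :
    fderiv ℝ G x u v w =
      G x (christoffelCLM G x u v) w + G x v (christoffelCLM G x u w) := by
  rw [h.self_of_nhds.symm v, form_christoffel h.self_of_nhds.inv,
    form_christoffel h.self_of_nhds.inv, fderiv_form_symm h w u v, fderiv_form_symm h v u w,
    fderiv_form_symm h u w v]
  ring

/-- The Gauss equation: the derivative of `dΦ(Γ(v,w)) = D²Φ(v,w) + C(v,w)`. -/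
theorem fderiv_apply_curvature {Φ : E → F} {x : E} (hΦ : ContDiffAt ℝ ∞ Φ x)
    {Γ : E → E →L[ℝ] E →L[ℝ] E} (hΓ : DifferentiableAt ℝ Γ x)
    {C : E → E →L[ℝ] E →L[ℝ] F} (hC : DifferentiableAt ℝ C x)
    (h : ∀ᶠ y in 𝓝 x, ∀ v w,
      fderiv ℝ Φ y (Γ y v w) = fderiv ℝ (fderiv ℝ Φ) y v w + C y v w) (u v w : E) :
    fderiv ℝ Φ x (fderiv ℝ Γ x u v w - fderiv ℝ Γ x v u w + Γ x u (Γ x v w) - Γ x v (Γ x u w)) =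
      fderiv ℝ C x u v w - fderiv ℝ C x v u w + C x u (Γ x v w) - C x v (Γ x u w) := by
  have h1 : ContDiffAt ℝ ∞ (fderiv ℝ Φ) x := contDiffAt_fderiv_top hΦ
  have h2 : ContDiffAt ℝ ∞ (fderiv ℝ (fderiv ℝ Φ)) x := contDiffAt_fderiv_top h1
  have d1 := (h1.differentiableAt (by simp)).hasFDerivAt
  have d2 := (h2.differentiableAt (by simp)).hasFDerivAt
  have key (a b c : E) : fderiv ℝ (fderiv ℝ Φ) x c (Γ x a b) + fderiv ℝ Φ x (fderiv ℝ Γ x c a b) =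
      fderiv ℝ (fderiv ℝ (fderiv ℝ Φ)) x c a b + fderiv ℝ C x c a b := by
    have e1 := d1.clm_apply ((hΓ.hasFDerivAt.clm_apply (hasFDerivAt_const a x)).clm_apply
      (hasFDerivAt_const b x))
    have e2 := ((d2.clm_apply (hasFDerivAt_const a x)).clm_apply (hasFDerivAt_const b x)).add
      ((hC.hasFDerivAt.clm_apply (hasFDerivAt_const a x)).clm_apply (hasFDerivAt_const b x))
    have e3 := (e1.congr_of_eventuallyEq (h.mono fun y hy => (hy a b).symm)).unique e2
    have e4 := DFunLike.congr_fun e3 c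
    simpa [add_comm] using e4
  have hs : fderiv ℝ (fderiv ℝ (fderiv ℝ Φ)) x u v = fderiv ℝ (fderiv ℝ (fderiv ℝ Φ)) x v u :=
    (h1.isSymmSndFDerivAt (by simpa using ENat.LEInfty.out)).eq u v
  have k1 := key v w u
  have k2 := key u w v
  have k3 := h.self_of_nhds u (Γ x v w)
  have k4 := h.self_of_nhds v (Γ x u w)
  rw [hs] at k1
  rw [← eq_sub_iff_add_eq'] at k1 k2
  simp only [map_add, map_sub, k1, k2, k3, k4]
  abel

end Coordinates

section Coordinates

variable {E : Type*} [NormedAddCommGroup E] [NormedSpace ℝ E]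
  {F : Type*} [NormedAddCommGroup F] [NormedSpace ℝ F]
  {H : Type*} [NormedAddCommGroup H] [NormedSpace ℝ H]

theorem fderiv_clm_apply₂ {F' : Type*} [NormedAddCommGroup F'] [NormedSpace ℝ F']
    {B : E → F →L[ℝ] F' →L[ℝ] H} {x : E} (h : DifferentiableAt ℝ B x) (u : E) (v : F) (w : F') : fderiv ℝ B x u v w = fderiv ℝ (fun y => B y v w) x u := by
  rw [((h.hasFDerivAt.clm_apply (hasFDerivAt_const v x)).clm_apply
    (hasFDerivAt_const w x)).fderiv]
  simp

/-- The pullback of a field of bilinear maps under `Φ`. -/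
def pullbackForm (Φ : E → F) (B : F → F →L[ℝ] F →L[ℝ] H) (x : E) : E →L[ℝ] E →L[ℝ] H :=
  ((ContinuousLinearMap.compL ℝ E F H).flip (fderiv ℝ Φ x)).comp ((B (Φ x)).comp (fderiv ℝ Φ x))

theorem pullbackForm_apply (Φ : E → F) (B : F → F →L[ℝ] F →L[ℝ] H) (x u v : E) :
    pullbackForm Φ B x u v = B (Φ x) (fderiv ℝ Φ x u) (fderiv ℝ Φ x v) := rfl

theorem contDiffAt_pullbackForm {Φ : E → F} {B : F → F →L[ℝ] F →L[ℝ] H} {x : E}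
    (hΦ : ContDiffAt ℝ ∞ Φ x) (hB : ContDiffAt ℝ ∞ B (Φ x)) :
    ContDiffAt ℝ ∞ (pullbackForm Φ B) x := by
  have h1 : ContDiffAt ℝ ∞ (fderiv ℝ Φ) x := contDiffAt_fderiv_top hΦ
  exact ((ContinuousLinearMap.contDiff _).contDiffAt.comp x h1).clm_comp
    ((hB.comp x hΦ).clm_comp h1)

theorem fderiv_pullbackForm {Φ : E → F} {B : F → F →L[ℝ] F →L[ℝ] H} {x : E}
    (hΦ : ContDiffAt ℝ ∞ Φ x) (hB : ContDiffAt ℝ ∞ B (Φ x)) (u v w : E) :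
    fderiv ℝ (pullbackForm Φ B) x u v w =
      fderiv ℝ B (Φ x) (fderiv ℝ Φ x u) (fderiv ℝ Φ x v) (fderiv ℝ Φ x w) +
      B (Φ x) (fderiv ℝ (fderiv ℝ Φ) x u v) (fderiv ℝ Φ x w) +
      B (Φ x) (fderiv ℝ Φ x v) (fderiv ℝ (fderiv ℝ Φ) x u w) := by
  have d0 := (hΦ.differentiableAt (by simp)).hasFDerivAt
  have d1 := ((contDiffAt_fderiv_top hΦ).differentiableAt (by simp)).hasFDerivAt
  have dB := (hB.differentiableAt (by simp)).hasFDerivAt.comp x d0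
  rw [fderiv_clm_apply₂ ((contDiffAt_pullbackForm hΦ hB).differentiableAt (by simp))]
  simp only [pullbackForm_apply]
  have key := (dB.clm_apply (d1.clm_apply (hasFDerivAt_const v x))).clm_apply
    (d1.clm_apply (hasFDerivAt_const w x))
  refine (DFunLike.congr_fun key.fderiv u).trans ?_
  simp only [add_apply, ContinuousLinearMap.comp_apply,
    ContinuousLinearMap.flip_apply, zero_apply, map_zero, zero_add,
    Function.comp_apply]
  abel

section Pullback

variable {Φ : E → F} {G : F → F →L[ℝ] F →L[ℝ] ℝ} {G' : E → E →L[ℝ] E →L[ℝ] ℝ} {x : E}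

theorem eventuallyEq_pullbackForm (hG' : ∀ᶠ y in 𝓝 x, ∀ u v,
    G' y u v = G (Φ y) (fderiv ℝ Φ y u) (fderiv ℝ Φ y v)) : G' =ᶠ[𝓝 x] pullbackForm Φ G := by
  filter_upwards [hG'] with y hy
  ext u v
  exact hy u v

theorem fderiv_injective_of_pullback (hG' : ∀ u v,
      G' x u v = G (Φ x) (fderiv ℝ Φ x u) (fderiv ℝ Φ x v)) (hm : IsMetricAt G' x) :
    Function.Injective (fderiv ℝ Φ x) := by
  rw [injective_iff_map_eq_zero]
  intro z hz
  refine hm.inv.injective ?_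
  ext v
  simp [hG', hz]

theorem fderiv_christoffel_of_pullback (hΦ : ContDiffAt ℝ ∞ Φ x)
    (hG : ∀ᶠ z in 𝓝 (Φ x), IsMetricAt G z)
    (hG' : ∀ᶠ y in 𝓝 x, ∀ u v, G' y u v = G (Φ y) (fderiv ℝ Φ y u) (fderiv ℝ Φ y v))
    (hm : ∀ᶠ y in 𝓝 x, IsMetricAt G' y) (hsurj : Function.Surjective (fderiv ℝ Φ x)) (v w : E) :
    fderiv ℝ Φ x (christoffelCLM G' x v w) = fderiv ℝ (fderiv ℝ Φ) x v w +
      christoffelCLM G (Φ x) (fderiv ℝ Φ x v) (fderiv ℝ Φ x w) := by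
  have hs (a b : E) : fderiv ℝ (fderiv ℝ Φ) x a b = fderiv ℝ (fderiv ℝ Φ) x b a :=
    (hΦ.isSymmSndFDerivAt (by simpa using ENat.LEInfty.out)).eq a b
  have hGs := hG.self_of_nhds
  refine hGs.inv.injective (ContinuousLinearMap.ext fun z => ?_)
  obtain ⟨z, rfl⟩ := hsurj z
  rw [← hG'.self_of_nhds, form_christoffel hm.self_of_nhds.inv, map_add,
    add_apply, form_christoffel hGs.inv,
    (eventuallyEq_pullbackForm hG').fderiv_eq,
    fderiv_pullbackForm hΦ hGs.smooth, fderiv_pullbackForm hΦ hGs.smooth,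
    fderiv_pullbackForm hΦ hGs.smooth, hs w v, hs z v, hs z w,
    hGs.symm (fderiv ℝ Φ x v), hGs.symm (fderiv ℝ Φ x w)]
  ring

/-- Naturality of the curvature under a local isometry `Φ`. -/
theorem fderiv_coordCurvature_of_pullback [CompleteSpace E] [CompleteSpace F]
    (hΦ : ∀ᶠ y in 𝓝 x, ContDiffAt ℝ ∞ Φ y)
    (hG : ∀ᶠ z in 𝓝 (Φ x), IsMetricAt G z)
    (hG' : ∀ᶠ y in 𝓝 x, ∀ u v, G' y u v = G (Φ y) (fderiv ℝ Φ y u) (fderiv ℝ Φ y v))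
    (hm : ∀ᶠ y in 𝓝 x, IsMetricAt G' y)
    (hsurj : ∀ᶠ y in 𝓝 x, Function.Surjective (fderiv ℝ Φ y)) (u v w : E) :
    fderiv ℝ Φ x (coordCurvature G' x u v w) =
      coordCurvature G (Φ x) (fderiv ℝ Φ x u) (fderiv ℝ Φ x v) (fderiv ℝ Φ x w) := by
  have hs (a b : E) : fderiv ℝ (fderiv ℝ Φ) x a b = fderiv ℝ (fderiv ℝ Φ) x b a :=
    (hΦ.self_of_nhds.isSymmSndFDerivAt (by simpa using ENat.LEInfty.out)).eq a b
  have hc : ∀ᶠ y in 𝓝 x, ∀ v w, fderiv ℝ Φ y (christoffelCLM G' y v w) =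
      fderiv ℝ (fderiv ℝ Φ) y v w + pullbackForm Φ (christoffelCLM G) y v w := by
    filter_upwards [hΦ, hΦ.self_of_nhds.continuousAt.eventually hG.eventually_nhds,
      hG'.eventually_nhds, hm.eventually_nhds, hsurj] with y h1 h2 h3 h4 h5
    exact fun v w => fderiv_christoffel_of_pullback h1 h2 h3 h4 h5 v w
  have hΓ := contDiffAt_christoffelCLM hm.self_of_nhds
  have hΓ' := contDiffAt_christoffelCLM hG.self_of_nhds
  rw [coordCurvature_eq (hΓ.differentiableAt (by simp)),
    coordCurvature_eq (hΓ'.differentiableAt (by simp)),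
    fderiv_apply_curvature hΦ.self_of_nhds (hΓ.differentiableAt (by simp))
    ((contDiffAt_pullbackForm hΦ.self_of_nhds hΓ').differentiableAt (by simp)) hc,
    fderiv_pullbackForm hΦ.self_of_nhds hΓ', fderiv_pullbackForm hΦ.self_of_nhds hΓ', hs v u]
  simp only [pullbackForm_apply, hc.self_of_nhds, map_add]
  abel

end Pullback

section Sphere

variable {V : Type*} [NormedAddCommGroup V] [InnerProductSpace ℝ V]
  {Φ : E → V} {G : E → E →L[ℝ] E →L[ℝ] ℝ} {x : E}

open scoped InnerProductSpace

theorem inner_fderiv_of_norm_eq_one (hΦ : DifferentiableAt ℝ Φ x)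
    (hn : ∀ᶠ y in 𝓝 x, ‖Φ y‖ = 1) (u : E) : ⟪Φ x, fderiv ℝ Φ x u⟫_ℝ = 0 := by
  have h1 := hΦ.hasFDerivAt.inner ℝ hΦ.hasFDerivAt
  have h2 : (fun y => ⟪Φ y, Φ y⟫_ℝ) =ᶠ[𝓝 x] fun _ => 1 := by
    filter_upwards [hn] with y hy
    rw [real_inner_self_eq_norm_sq, hy, one_pow]
  have h3 := DFunLike.congr_fun (h1.unique ((hasFDerivAt_const (1 : ℝ) x).congr_of_eventuallyEq h2)) u
  simp only [fderivInnerCLM_apply, ContinuousLinearMap.comp_apply,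
    ContinuousLinearMap.prod_apply, zero_apply] at h3
  rw [real_inner_comm (Φ x)] at h3
  linarith

theorem fderiv_christoffel_of_sphere (hΦ : ∀ᶠ y in 𝓝 x, ContDiffAt ℝ ∞ Φ y)
    (hn : ∀ᶠ y in 𝓝 x, ‖Φ y‖ = 1)
    (hG : ∀ᶠ y in 𝓝 x, ∀ u v, G y u v = ⟪fderiv ℝ Φ y u, fderiv ℝ Φ y v⟫_ℝ)
    (hm : ∀ᶠ y in 𝓝 x, IsMetricAt G y)
    (hspan : ∀ z, (∀ u, ⟪z, fderiv ℝ Φ x u⟫_ℝ = 0) → ⟪z, Φ x⟫_ℝ = 0 → z = 0) (v w : E) :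
    fderiv ℝ Φ x (christoffelCLM G x v w) =
      fderiv ℝ (fderiv ℝ Φ) x v w + G x v w • Φ x := by
  have hΦx := hΦ.self_of_nhds
  have hs (a b : E) : fderiv ℝ (fderiv ℝ Φ) x a b = fderiv ℝ (fderiv ℝ Φ) x b a :=
    (hΦx.isSymmSndFDerivAt (by simpa using ENat.LEInfty.out)).eq a b
  have horth := inner_fderiv_of_norm_eq_one (hΦx.differentiableAt (by simp)) hn
  have d1 := ((contDiffAt_fderiv_top hΦx).differentiableAt (by simp)).hasFDerivAt
  have hGe := (eventuallyEq_pullbackForm (Φ := Φ) (G := fun _ => (innerSL ℝ : V →L[ℝ] V →L[ℝ] ℝ)) hG).fderiv_eq (𝕜 := ℝ)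
  have hB : ContDiffAt ℝ ∞ (fun _ : V => (innerSL ℝ : V →L[ℝ] V →L[ℝ] ℝ)) (Φ x) := contDiffAt_const
  have hi (a b : V) : (innerSL ℝ : V →L[ℝ] V →L[ℝ] ℝ) a b = ⟪a, b⟫_ℝ := rfl
  refine sub_eq_zero.1 (hspan _ (fun u => ?_) ?_)
  · rw [inner_sub_left, inner_add_left, real_inner_smul_left, horth, ← hG.self_of_nhds,
      form_christoffel hm.self_of_nhds.inv, hGe, fderiv_pullbackForm hΦx hB,
      fderiv_pullbackForm hΦx hB, fderiv_pullbackForm hΦx hB, hs w v, hs u v, hs u w]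
    simp only [fderiv_fun_const, Pi.zero_apply, zero_apply, hi]
    rw [real_inner_comm (fderiv ℝ (fderiv ℝ Φ) x v u)]
    ring
  · have h1 : ⟪fderiv ℝ (fderiv ℝ Φ) x v w, Φ x⟫_ℝ + ⟪fderiv ℝ Φ x w, fderiv ℝ Φ x v⟫_ℝ = 0 := by
      have e1 := (d1.clm_apply (hasFDerivAt_const w x)).inner ℝ
        (hΦx.differentiableAt (by simp)).hasFDerivAt
      have e2 : (fun y => ⟪fderiv ℝ Φ y w, Φ y⟫_ℝ) =ᶠ[𝓝 x] fun _ => 0 := by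
        filter_upwards [hn.eventually_nhds, hΦ] with y h1 h2
        rw [real_inner_comm]
        exact inner_fderiv_of_norm_eq_one (h2.differentiableAt (by simp)) h1 w
      have e3 := DFunLike.congr_fun
        (e1.unique ((hasFDerivAt_const (0 : ℝ) x).congr_of_eventuallyEq e2)) v
      simp only [fderivInnerCLM_apply, ContinuousLinearMap.comp_apply,
        ContinuousLinearMap.prod_apply, zero_apply,
        add_apply, ContinuousLinearMap.flip_apply, map_zero, zero_add] at e3
      linarith
    rw [inner_sub_left, inner_add_left, real_inner_smul_left, real_inner_self_eq_norm_sq,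
      hn.self_of_nhds, hG.self_of_nhds, real_inner_comm, horth,
      real_inner_comm (fderiv ℝ Φ x w)]
    linarith

/-- The curvature of a metric induced by an immersion into the unit sphere as a hypersurface. -/
theorem coordCurvature_of_sphere [CompleteSpace E] (hΦ : ∀ᶠ y in 𝓝 x, ContDiffAt ℝ ∞ Φ y)
    (hn : ∀ᶠ y in 𝓝 x, ‖Φ y‖ = 1)
    (hG : ∀ᶠ y in 𝓝 x, ∀ u v, G y u v = ⟪fderiv ℝ Φ y u, fderiv ℝ Φ y v⟫_ℝ)
    (hm : ∀ᶠ y in 𝓝 x, IsMetricAt G y)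
    (hspan : ∀ᶠ y in 𝓝 x, ∀ z, (∀ u, ⟪z, fderiv ℝ Φ y u⟫_ℝ = 0) → ⟪z, Φ y⟫_ℝ = 0 → z = 0)
    (u v w : E) :
    coordCurvature G x u v w = G x v w • u - G x u w • v := by
  have hmx := hm.self_of_nhds
  have hΦx := hΦ.self_of_nhds
  have hΓ := contDiffAt_christoffelCLM hmx
  let C : E → E →L[ℝ] E →L[ℝ] V := fun y =>
    (ContinuousLinearMap.compL ℝ E ℝ V ((ContinuousLinearMap.lsmul ℝ ℝ).flip (Φ y))).comp (G y)
  have hCa (y v w : E) : C y v w = G y v w • Φ y := rfl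
  have hC : ContDiffAt ℝ ∞ C x :=
    ContDiffAt.clm_comp ((ContinuousLinearMap.contDiff _).contDiffAt.comp x
      ((ContinuousLinearMap.contDiff _).contDiffAt.comp x hΦx)) hmx.smooth
  have hc : ∀ᶠ y in 𝓝 x, ∀ v w, fderiv ℝ Φ y (christoffelCLM G y v w) =
      fderiv ℝ (fderiv ℝ Φ) y v w + C y v w := by
    filter_upwards [hΦ.eventually_nhds, hn.eventually_nhds, hG.eventually_nhds,
      hm.eventually_nhds, hspan] with y h1 h2 h3 h4 h5
    exact fun v w => fderiv_christoffel_of_sphere h1 h2 h3 h4 h5 v w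
  have hCd (u v w : E) : fderiv ℝ C x u v w =
      (G x (christoffelCLM G x u v) w + G x v (christoffelCLM G x u w)) • Φ x +
        G x v w • fderiv ℝ Φ x u := by
    rw [fderiv_clm_apply₂ (hC.differentiableAt (by simp)), ← fderiv_form hm]
    simp only [hCa]
    have e := (((hmx.smooth.differentiableAt (by simp)).hasFDerivAt.clm_apply
      (hasFDerivAt_const v x)).clm_apply (hasFDerivAt_const w x)).smul
      (hΦx.differentiableAt (by simp)).hasFDerivAt
    refine (DFunLike.congr_fun e.fderiv u).trans ?_
    simp [add_comm]
  have hinj := fderiv_injective_of_pullback (Φ := Φ) (G := fun _ => (innerSL ℝ : V →L[ℝ] V →L[ℝ] ℝ))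
    hG.self_of_nhds hmx
  apply hinj
  rw [coordCurvature_eq (hΓ.differentiableAt (by simp)),
    fderiv_apply_curvature hΦx (hΓ.differentiableAt (by simp))
      (hC.differentiableAt (by simp)) hc, hCd, hCd, hCa, hCa, map_sub, map_smul, map_smul,
      christoffel_symm hm v u]
  module

end Sphere

end Coordinates

section Coordinates

variable {E : Type*} [NormedAddCommGroup E] [NormedSpace ℝ E]
  {F : Type*} [NormedAddCommGroup F] [NormedSpace ℝ F]

section Product

variable {G₁ : E → E →L[ℝ] E →L[ℝ] ℝ} {G₂ : F → F →L[ℝ] F →L[ℝ] ℝ}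
  {G : E × F → E × F →L[ℝ] E × F →L[ℝ] ℝ} {x : E × F}

theorem fderiv_prod_form (h₁ : DifferentiableAt ℝ G₁ x.1) (h₂ : DifferentiableAt ℝ G₂ x.2)
    (h : DifferentiableAt ℝ G x)
    (hG : ∀ᶠ y in 𝓝 x, ∀ u v, G y u v = G₁ y.1 u.1 v.1 + G₂ y.2 u.2 v.2) (u v w : E × F) :
    fderiv ℝ G x u v w = fderiv ℝ G₁ x.1 u.1 v.1 w.1 + fderiv ℝ G₂ x.2 u.2 v.2 w.2 := by
  rw [fderiv_clm_apply₂ h, Filter.EventuallyEq.fderiv_eq (hG.mono fun y hy => hy v w)]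
  have e1 := (((h₁.hasFDerivAt.comp x hasFDerivAt_fst).clm_apply
    (hasFDerivAt_const v.1 x)).clm_apply (hasFDerivAt_const w.1 x))
  have e2 := (((h₂.hasFDerivAt.comp x hasFDerivAt_snd).clm_apply
    (hasFDerivAt_const v.2 x)).clm_apply (hasFDerivAt_const w.2 x))
  refine (DFunLike.congr_fun (e1.add e2).fderiv u).trans ?_
  simp

theorem christoffel_prod (h₁ : IsMetricAt G₁ x.1) (h₂ : IsMetricAt G₂ x.2) (h : IsMetricAt G x)
    (hG : ∀ᶠ y in 𝓝 x, ∀ u v, G y u v = G₁ y.1 u.1 v.1 + G₂ y.2 u.2 v.2) (u v : E × F) :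
    christoffelCLM G x u v =
      (christoffelCLM G₁ x.1 u.1 v.1, christoffelCLM G₂ x.2 u.2 v.2) := by
  have hd := fderiv_prod_form (h₁.smooth.differentiableAt (by simp))
    (h₂.smooth.differentiableAt (by simp)) (h.smooth.differentiableAt (by simp)) hG
  refine christoffel_eq_of_forall h.inv fun w => ?_
  rw [hG.self_of_nhds, form_christoffel h₁.inv, form_christoffel h₂.inv, hd, hd, hd]
  ring

theorem coordCurvature_prod [CompleteSpace E] [CompleteSpace F]
    (h₁ : ∀ᶠ y in 𝓝 x.1, IsMetricAt G₁ y) (h₂ : ∀ᶠ y in 𝓝 x.2, IsMetricAt G₂ y)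
    (h : ∀ᶠ y in 𝓝 x, IsMetricAt G y)
    (hG : ∀ᶠ y in 𝓝 x, ∀ u v, G y u v = G₁ y.1 u.1 v.1 + G₂ y.2 u.2 v.2) (u v w : E × F) :
    coordCurvature G x u v w =
      (coordCurvature G₁ x.1 u.1 v.1 w.1, coordCurvature G₂ x.2 u.2 v.2 w.2) := by
  have hc : ∀ᶠ y in 𝓝 x, ∀ u v, christoffelCLM G y u v =
      (christoffelCLM G₁ y.1 u.1 v.1, christoffelCLM G₂ y.2 u.2 v.2) := by
    filter_upwards [continuousAt_fst.eventually h₁, continuousAt_snd.eventually h₂, h,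
      hG.eventually_nhds] with y k1 k2 k3 k4
    exact fun u v => christoffel_prod k1 k2 k3 k4 u v
  have d1 := (contDiffAt_christoffelCLM h₁.self_of_nhds).differentiableAt (by simp)
  have d2 := (contDiffAt_christoffelCLM h₂.self_of_nhds).differentiableAt (by simp)
  have d := (contDiffAt_christoffelCLM h.self_of_nhds).differentiableAt (by simp)
  have hd (u v w : E × F) : fderiv ℝ (christoffelCLM G) x u v w =
      (fderiv ℝ (christoffelCLM G₁) x.1 u.1 v.1 w.1,
        fderiv ℝ (christoffelCLM G₂) x.2 u.2 v.2 w.2) := by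
    rw [fderiv_clm_apply₂ d, Filter.EventuallyEq.fderiv_eq (hc.mono fun y hy => hy v w)]
    have e1 := (((d1.hasFDerivAt.comp x hasFDerivAt_fst).clm_apply
      (hasFDerivAt_const v.1 x)).clm_apply (hasFDerivAt_const w.1 x))
    have e2 := (((d2.hasFDerivAt.comp x hasFDerivAt_snd).clm_apply
      (hasFDerivAt_const v.2 x)).clm_apply (hasFDerivAt_const w.2 x))
    refine (DFunLike.congr_fun (e1.prodMk e2).fderiv u).trans ?_
    simp
  rw [coordCurvature_eq d1, coordCurvature_eq d2, coordCurvature_eq d]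
  simp only [hd, hc.self_of_nhds]
  rfl

end Product

variable [CompleteSpace E] {G : E → E →L[ℝ] E →L[ℝ] ℝ} {x : E}

theorem form_curvature_antisymm (h : ∀ᶠ y in 𝓝 x, IsMetricAt G y) (u v w z : E) :
    G x (coordCurvature G x u v w) z = - G x (coordCurvature G x u v z) w := by
  have hm := h.self_of_nhds
  have dG := (hm.smooth.differentiableAt (by simp)).hasFDerivAt
  have dG' := ((contDiffAt_fderiv_top hm.smooth).differentiableAt (by simp)).hasFDerivAt
  have dΓ' := (contDiffAt_christoffelCLM hm).differentiableAt (by simp)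
  have dΓ := dΓ'.hasFDerivAt
  have key (u v : E) : fderiv ℝ (fderiv ℝ G) x u v w z =
      fderiv ℝ G x u (christoffelCLM G x v w) z + G x (fderiv ℝ (christoffelCLM G) x u v w) z +
      (fderiv ℝ G x u (christoffelCLM G x v z) w +
        G x (fderiv ℝ (christoffelCLM G) x u v z) w) := by
    have c (a : E) := hasFDerivAt_const (𝕜 := ℝ) a x
    have e1 := ((dG'.clm_apply (c v)).clm_apply (c w)).clm_apply (c z)
    have e2 := ((dG.clm_apply ((dΓ.clm_apply (c v)).clm_apply (c w))).clm_apply (c z)).add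
      ((dG.clm_apply ((dΓ.clm_apply (c v)).clm_apply (c z))).clm_apply (c w))
    have e3 := e1.congr_of_eventuallyEq (f₁ := fun y => G y (christoffelCLM G y v w) z +
        G y (christoffelCLM G y v z) w) (by
      filter_upwards [h.eventually_nhds] with y hy
      rw [fderiv_form hy v w z, hy.self_of_nhds.symm w])
    have e4 := DFunLike.congr_fun (e3.unique e2) u
    simp only [add_apply, ContinuousLinearMap.comp_apply, ContinuousLinearMap.flip_apply,
      zero_apply, map_zero, zero_add] at e4
    rw [e4]
    ring
  have hs : fderiv ℝ (fderiv ℝ G) x u v = fderiv ℝ (fderiv ℝ G) x v u :=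
    (hm.smooth.isSymmSndFDerivAt (by simpa using ENat.LEInfty.out)).eq u v
  have k1 := key u v
  have k2 := key v u
  rw [hs, k2] at k1
  simp only [fderiv_form h] at k1
  rw [coordCurvature_eq dΓ', coordCurvature_eq dΓ']
  simp only [map_add, map_sub, add_apply, sub_apply]
  simp only [hm.symm (christoffelCLM G x _ _) (christoffelCLM G x _ _)] at k1
  linarith

/-- On a surface, the sectional curvature determines the curvature tensor. -/
theorem coordCurvature_of_sectional (h : ∀ᶠ y in 𝓝 x, IsMetricAt G y) {k : ℝ}
    (e : Module.Basis (Fin 2) ℝ E)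
    (hk : G x (coordCurvature G x (e 0) (e 1) (e 1)) (e 0) =
      k * (G x (e 0) (e 0) * G x (e 1) (e 1) - G x (e 0) (e 1) ^ 2)) (u v w : E) :
    coordCurvature G x u v w = k • (G x v w • u - G x u w • v) := by
  have hm := h.self_of_nhds
  have dΓ := (contDiffAt_christoffelCLM hm).differentiableAt (by simp)
  have hexp (z : E) : ∃ a b : ℝ, z = a • e 0 + b • e 1 :=
    ⟨e.repr z 0, e.repr z 1, by rw [← Fin.sum_univ_two (fun i => e.repr z i • e i), e.sum_repr]⟩
  obtain ⟨a₀, a₁, rfl⟩ := hexp u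
  obtain ⟨b₀, b₁, rfl⟩ := hexp v
  have h1 : coordCurvature G x (a₀ • e 0 + a₁ • e 1) (b₀ • e 0 + b₁ • e 1) w =
      (a₀ * b₁ - a₁ * b₀) • coordCurvature G x (e 0) (e 1) w := by
    simp only [coordCurvature_eq dΓ, map_add, map_smul, add_apply, smul_apply]
    module
  obtain ⟨c₀, c₁, rfl⟩ := hexp w
  have h2 : coordCurvature G x (e 0) (e 1) (c₀ • e 0 + c₁ • e 1) =
      c₀ • coordCurvature G x (e 0) (e 1) (e 0) + c₁ • coordCurvature G x (e 0) (e 1) (e 1) := by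
    simp only [coordCurvature_eq dΓ, map_add, map_smul]
    module
  refine hm.inv.injective (ContinuousLinearMap.ext fun z => ?_)
  obtain ⟨d₀, d₁, rfl⟩ := hexp z
  have k0 := form_curvature_antisymm h (e 0) (e 1) (e 0) (e 0)
  have k1 := form_curvature_antisymm h (e 0) (e 1) (e 1) (e 1)
  have k2 := form_curvature_antisymm h (e 0) (e 1) (e 0) (e 1)
  rw [hk] at k2
  rw [eq_neg_iff_add_eq_zero, add_self_eq_zero] at k0 k1
  rw [h1, h2]
  simp only [map_add, map_sub, map_smul, add_apply, sub_apply, smul_apply, smul_eq_mul,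
    k0, k1, k2, hk, hm.symm (e 1) (e 0)]
  ring

end Coordinates

section Frobenius

variable {E : Type*} [NormedAddCommGroup E] [NormedSpace ℝ E]
  {W : Type*} [NormedAddCommGroup W] [NormedSpace ℝ W]

/-- Quantitative control of a connection form `A` on a ball around `x₀`. -/
structure ConnectionBounds (A : E → E →L[ℝ] W →L[ℝ] W) (x₀ : E) (δ C : ℝ) : Prop where
  pos : 0 < δ
  le_one : δ ≤ 1
  nonneg : 0 ≤ C
  small : C * δ ≤ 1 / 2
  diff : ∀ y ∈ Metric.ball x₀ δ, DifferentiableAt ℝ A y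
  flat : ∀ y ∈ Metric.ball x₀ δ, ∀ u v w, fderiv ℝ A y v u w + A y u (A y v w) =
    fderiv ℝ A y u v w + A y v (A y u w)
  bound : ∀ y ∈ Metric.ball x₀ δ, ‖A y‖ ≤ C
  lip : ∀ y ∈ Metric.ball x₀ δ, ∀ z ∈ Metric.ball x₀ δ, ‖A z - A y‖ ≤ C * ‖z - y‖
  taylor : ∀ y ∈ Metric.ball x₀ δ, ∀ z ∈ Metric.ball x₀ δ,
    ‖A z - A y - fderiv ℝ A y (z - y)‖ ≤ C * ‖z - y‖ ^ 2

theorem exists_connectionBounds {A : E → E →L[ℝ] W →L[ℝ] W} {x₀ : E}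
    (hA : ∀ᶠ y in 𝓝 x₀, ContDiffAt ℝ ∞ A y)
    (hflat : ∀ᶠ y in 𝓝 x₀, ∀ u v w, fderiv ℝ A y v u w + A y u (A y v w) =
      fderiv ℝ A y u v w + A y v (A y u w)) :
    ∃ δ C, ConnectionBounds A x₀ δ C := by
  have h0 := hA.self_of_nhds
  obtain ⟨K, s, hs, hK⟩ := (h0.of_le (m := 1) (by simp)).exists_lipschitzOnWith
  obtain ⟨K', s', hs', hK'⟩ :=
    ((contDiffAt_fderiv_top h0).of_le (m := 1) (by simp)).exists_lipschitzOnWith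
  have hb : ∀ᶠ y in 𝓝 x₀, ‖A y‖ < ‖A x₀‖ + 1 :=
    h0.continuousAt.norm.eventually_lt_const (lt_add_one _)
  obtain ⟨r, hr, hball⟩ := Metric.eventually_nhds_iff_ball.1
    (hA.and (hflat.and (hb.and ((eventually_mem_set.2 hs).and (eventually_mem_set.2 hs')))))
  set C : ℝ := ‖A x₀‖ + 1 + K + K' with hC
  have hC0 : 0 < C := by positivity
  refine ⟨min r (min 1 (1 / (2 * C))), C, ⟨by positivity, by simp, hC0.le, ?_, ?_, ?_, ?_, ?_, ?_⟩⟩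
  · calc C * min r (min 1 (1 / (2 * C))) ≤ C * (1 / (2 * C)) := by
          gcongr
          exact (min_le_right _ _).trans (min_le_right _ _)
      _ = 1 / 2 := by field_simp
  all_goals
    intro y hy
    have hyr : y ∈ Metric.ball x₀ r := Metric.ball_subset_ball (min_le_left _ _) hy
    obtain ⟨h1, h2, h3, h4, h5⟩ := hball y hyr
  · exact h1.differentiableAt (by simp)
  · exact h2
  · refine h3.le.trans ?_
    rw [hC]
    linarith [K.2, K'.2]
  · intro z hz
    have hz' := (hball z (Metric.ball_subset_ball (min_le_left _ _) hz)).2.2.2.1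
    refine (hK.norm_sub_le hz' h4).trans ?_
    gcongr
    rw [hC]
    linarith [K'.2, norm_nonneg (A x₀)]
  · intro z hz
    have hseg : segment ℝ y z ⊆ Metric.ball x₀ r :=
      (convex_ball x₀ r).segment_subset hyr (Metric.ball_subset_ball (min_le_left _ _) hz)
    have := Convex.norm_image_sub_le_of_norm_fderiv_le' (𝕜 := ℝ) (f := A) (C := C * ‖z - y‖)
      (φ := fderiv ℝ A y) (s := segment ℝ y z)
      (fun ζ hζ => (hball ζ (hseg hζ)).1.differentiableAt (by simp)) (fun ζ hζ => by
        refine (hK'.norm_sub_le (hball ζ (hseg hζ)).2.2.2.2 h5).trans ?_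
        gcongr
        · rw [hC]
          linarith [K.2, norm_nonneg (A x₀)]
        · obtain ⟨a, b, ha, hb, hab, rfl⟩ := hζ
          have : a • y + b • z - y = b • (z - y) := by
            rw [← eq_sub_iff_add_eq] at hab
            rw [hab]
            module
          rw [this, norm_smul, Real.norm_of_nonneg hb]
          exact mul_le_of_le_one_left (norm_nonneg _) (by linarith))
      (convex_segment y z) (left_mem_segment ℝ y z) (right_mem_segment ℝ y z)
    calc _ ≤ _ := this
      _ = _ := by ring

variable {A : E → E →L[ℝ] W →L[ℝ] W} {x₀ : E} {δ C : ℝ}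

theorem ray_mem_ball {h : E} (hh : ‖h‖ < δ) {t : ℝ}
    (ht : t ∈ Icc (0 : ℝ) 1) : x₀ + t • h ∈ Metric.ball x₀ δ := by
  rw [mem_ball_iff_norm, add_sub_cancel_left, norm_smul, Real.norm_of_nonneg ht.1]
  exact (mul_le_of_le_one_left (norm_nonneg _) ht.2).trans_lt hh

theorem ConnectionBounds.norm_ray_le (hb : ConnectionBounds A x₀ δ C) {h : E} (hh : ‖h‖ < δ) {t : ℝ}
    (ht : t ∈ Icc (0 : ℝ) 1) (w : W) : ‖A (x₀ + t • h) h w‖ ≤ 1 / 2 * ‖w‖ := by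
  refine ((A (x₀ + t • h) h).le_opNorm w).trans ?_
  gcongr
  refine ((A (x₀ + t • h)).le_opNorm h).trans (le_trans ?_ hb.small)
  exact mul_le_mul (hb.bound _ (ray_mem_ball hh ht)) hh.le (norm_nonneg _) hb.nonneg

theorem hasDerivAt_ray (x₀ h : E) (t : ℝ) : HasDerivAt (fun t : ℝ => x₀ + t • h) h t := by
  simpa using ((hasDerivAt_id t).smul_const h).const_add x₀

/-- Parallel transport along the ray from `x₀` to `x₀ + h`. -/
theorem ConnectionBounds.exists_transport [CompleteSpace W] (hb : ConnectionBounds A x₀ δ C)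
    (w₀ : W) {h : E} (hh : ‖h‖ < δ) : ∃ α : ℝ → W, α 0 = w₀ ∧
      (∀ t ∈ Icc (0 : ℝ) 1, HasDerivWithinAt α (A (x₀ + t • h) h (α t)) (Icc 0 1) t) ∧
      ∀ t ∈ Icc (0 : ℝ) 1, ‖α t‖ ≤ ‖w₀‖ * Real.exp 1 := by
  have hP : IsPicardLindelof (fun t w => A (x₀ + t • h) h w)
      (⟨0, by simp⟩ : Icc (0 : ℝ) 1) w₀ (‖w₀‖₊ + 1) 0 (‖w₀‖₊ + 1) (1 / 2) := by
    refine ⟨fun t ht => ?_, fun w _ => ?_, fun t ht w hw => ?_, ?_⟩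
    · refine LipschitzOnWith.of_dist_le_mul fun a _ b _ => ?_
      rw [dist_eq_norm, dist_eq_norm, ← map_sub]
      simpa using hb.norm_ray_le hh ht (a - b)
    · intro t ht
      have := ((hb.diff _ (ray_mem_ball hh ht)).continuousAt.comp (f := fun t : ℝ => x₀ + t • h)
        (hasDerivAt_ray x₀ h t).continuousAt)
      exact ((this.clm_apply continuousAt_const).clm_apply continuousAt_const).continuousWithinAt
    · refine (hb.norm_ray_le hh ht w).trans ?_
      have h1 : ‖w‖ ≤ ‖w - w₀‖ + ‖w₀‖ := by simpa using norm_add_le (w - w₀) w₀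
      have h2 : ‖w - w₀‖ ≤ ‖w₀‖ + 1 := by simpa [dist_eq_norm] using hw
      push_cast
      linarith [norm_nonneg w₀]
    · simp
  obtain ⟨α, h0, hα⟩ := hP.exists_eq_forall_mem_Icc_hasDerivWithinAt₀
  refine ⟨α, h0, hα, fun t ht => ?_⟩
  have := norm_le_gronwallBound_of_norm_deriv_right_le (K := 1) (ε := 0)
    (fun t ht => (hα t ht).continuousWithinAt)
    (fun t ht => (hα t (Ico_subset_Icc_self ht)).mono_of_mem_nhdsWithin (Icc_mem_nhdsGE_of_mem ht))
    (by rw [h0]) (fun t ht => by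
      refine (hb.norm_ray_le hh (Ico_subset_Icc_self ht) (α t)).trans ?_
      linarith [norm_nonneg (α t)]) t ht
  rw [gronwallBound_ε0] at this
  refine this.trans ?_
  gcongr
  linarith [ht.2]

theorem ConnectionBounds.transport_sub_le (hb : ConnectionBounds A x₀ δ C) {h k : E}
    (hh : ‖h‖ < δ) (hk : ‖h + k‖ < δ) {α β : ℝ → W} {B : ℝ} (h0 : α 0 = β 0)
    (hα : ∀ t ∈ Icc (0 : ℝ) 1, HasDerivWithinAt α (A (x₀ + t • h) h (α t)) (Icc 0 1) t)
    (hβ : ∀ t ∈ Icc (0 : ℝ) 1,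
      HasDerivWithinAt β (A (x₀ + t • (h + k)) (h + k) (β t)) (Icc 0 1) t)
    (hB : ∀ t ∈ Icc (0 : ℝ) 1, ‖α t‖ ≤ B) :
    ‖β 1 - α 1 - A (x₀ + h) k (α 1)‖ ≤ (2 * C + 2 * C ^ 2) * B * (Real.exp 1 - 1) * ‖k‖ ^ 2 := by
  set z : ℝ → E := fun t => x₀ + t • h with hz
  set z' : ℝ → E := fun t => x₀ + t • (h + k) with hz'
  set Q : ℝ → W := fun t => β t - α t - A (z t) (t • k) (α t) with hQ
  have hB0 : 0 ≤ B := (norm_nonneg _).trans (hB 0 (by simp))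
  have hC := hb.nonneg
  have hQ' (t : ℝ) (ht : t ∈ Icc (0 : ℝ) 1) : HasDerivWithinAt Q
      (A (z' t) (h + k) (Q t) +
        ((A (z' t) - A (z t) - fderiv ℝ A (z t) (t • k)) h (α t) +
        (A (z' t) - A (z t)) k (α t) +
        ((A (z' t) - A (z t)) h + A (z' t) k) (A (z t) (t • k) (α t)))) (Icc 0 1) t := by
    have d1 : HasDerivWithinAt (fun t => A (z t)) (fderiv ℝ A (z t) h) (Icc 0 1) t :=
      ((hb.diff _ (ray_mem_ball hh ht)).hasFDerivAt.comp_hasDerivAt t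
        (hasDerivAt_ray x₀ h t)).hasDerivWithinAt
    have d2 : HasDerivWithinAt (fun t : ℝ => t • k) k (Icc 0 1) t := by
      simpa using ((hasDerivAt_id t).smul_const k).hasDerivWithinAt
    have d3 := ((hβ t ht).sub (hα t ht)).sub ((d1.clm_apply d2).clm_apply (hα t ht))
    refine d3.congr_deriv ?_
    have hfl := hb.flat _ (ray_mem_ball hh ht) (t • k) h (α t)
    have e : β t = Q t + α t + A (z t) (t • k) (α t) := by
      simp only [hQ]
      abel
    rw [← hz'] at *
    change A (z' t) (h + k) (β t) - A (z t) h (α t) -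
      ((fderiv ℝ A (z t) h (t • k) + A (z t) k) (α t) +
        A (z t) (t • k) (A (z t) h (α t))) = _
    rw [e]
    change fderiv ℝ A (z t) h (t • k) (α t) + A (z t) (t • k) (A (z t) h (α t)) =
      fderiv ℝ A (z t) (t • k) h (α t) + A (z t) h (A (z t) (t • k) (α t)) at hfl
    rw [← sub_eq_zero] at hfl ⊢
    simp only [add_apply, sub_apply, map_add] at hfl ⊢
    rw [← neg_eq_zero, ← hfl]
    abel
  have hest (t : ℝ) (ht : t ∈ Icc (0 : ℝ) 1) :
      ‖(A (z' t) - A (z t) - fderiv ℝ A (z t) (t • k)) h (α t) +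
        (A (z' t) - A (z t)) k (α t) +
        ((A (z' t) - A (z t)) h + A (z' t) k) (A (z t) (t • k) (α t))‖ ≤
      (2 * C + 2 * C ^ 2) * B * ‖k‖ ^ 2 := by
    have hzt := ray_mem_ball (x₀ := x₀) hh ht
    have hzt' := ray_mem_ball (x₀ := x₀) hk ht
    have hh1 : ‖h‖ ≤ 1 := hh.le.trans hb.le_one
    have hsub : z' t - z t = t • k := by
      simp only [hz, hz']
      module
    have htk : ‖t • k‖ ≤ ‖k‖ := by
      rw [norm_smul, Real.norm_of_nonneg ht.1]
      exact mul_le_of_le_one_left (norm_nonneg _) ht.2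
    have hα' := hB t ht
    have t1 : ‖A (z' t) - A (z t) - fderiv ℝ A (z t) (t • k)‖ ≤ C * ‖k‖ ^ 2 := by
      have := hb.taylor _ hzt _ hzt'
      change ‖A (z' t) - A (z t) - fderiv ℝ A (z t) (z' t - z t)‖ ≤ C * ‖z' t - z t‖ ^ 2 at this
      rw [hsub] at this
      exact this.trans (by gcongr)
    have t2 : ‖A (z' t) - A (z t)‖ ≤ C * ‖k‖ := by
      have := hb.lip _ hzt _ hzt'
      change ‖A (z' t) - A (z t)‖ ≤ C * ‖z' t - z t‖ at this
      rw [hsub] at this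
      exact this.trans (by gcongr)
    have n1 : ‖(A (z' t) - A (z t) - fderiv ℝ A (z t) (t • k)) h (α t)‖ ≤
        C * ‖k‖ ^ 2 * 1 * B :=
      ((ContinuousLinearMap.le_opNorm₂ _ _ _)).trans (by gcongr)
    have n2 : ‖(A (z' t) - A (z t)) k (α t)‖ ≤ C * ‖k‖ * ‖k‖ * B :=
      ((ContinuousLinearMap.le_opNorm₂ _ _ _)).trans (by gcongr)
    have n3 : ‖A (z t) (t • k) (α t)‖ ≤ C * ‖k‖ * B :=
      ((ContinuousLinearMap.le_opNorm₂ _ _ _)).trans (by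
        gcongr
        exact hb.bound _ hzt)
    have n4 : ‖(A (z' t) - A (z t)) h + A (z' t) k‖ ≤ C * ‖k‖ * 1 + C * ‖k‖ := by
      refine (norm_add_le _ _).trans (add_le_add ?_ ?_)
      · exact (ContinuousLinearMap.le_opNorm _ _).trans (by gcongr)
      · refine (ContinuousLinearMap.le_opNorm _ _).trans ?_
        gcongr
        exact hb.bound _ hzt'
    have n5 : ‖((A (z' t) - A (z t)) h + A (z' t) k) (A (z t) (t • k) (α t))‖ ≤
        (C * ‖k‖ * 1 + C * ‖k‖) * (C * ‖k‖ * B) :=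
      (ContinuousLinearMap.le_opNorm _ _).trans (by gcongr)
    calc _ ≤ C * ‖k‖ ^ 2 * 1 * B + C * ‖k‖ * ‖k‖ * B +
          (C * ‖k‖ * 1 + C * ‖k‖) * (C * ‖k‖ * B) :=
          (norm_add_le _ _).trans (add_le_add ((norm_add_le _ _).trans (add_le_add n1 n2)) n5)
      _ = _ := by ring
  have := norm_le_gronwallBound_of_norm_deriv_right_le (K := 1) (δ := 0)
    (ε := (2 * C + 2 * C ^ 2) * B * ‖k‖ ^ 2)
    (fun t ht => (hQ' t ht).continuousWithinAt)
    (fun t ht => (hQ' t (Ico_subset_Icc_self ht)).mono_of_mem_nhdsWithin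
      (Icc_mem_nhdsGE_of_mem ht))
    (by simp [hQ, h0]) (fun t ht => by
      refine (norm_add_le _ _).trans (add_le_add ?_ (hest t (Ico_subset_Icc_self ht)))
      refine (hb.norm_ray_le hk (Ico_subset_Icc_self ht) (Q t)).trans ?_
      linarith [norm_nonneg (Q t)]) 1 (by simp)
  rw [gronwallBound_of_K_ne_0 one_ne_zero] at this
  simp only [hQ, hz, one_smul, zero_mul, zero_add, sub_zero, div_one, mul_one] at this
  calc _ ≤ _ := this
    _ = _ := by ring

/-- A flat connection has a parallel section with any prescribed value at a point. -/
theorem exists_parallel_section [CompleteSpace W] {A : E → E →L[ℝ] W →L[ℝ] W} {x₀ : E}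
    (hA : ∀ᶠ y in 𝓝 x₀, ContDiffAt ℝ ∞ A y)
    (hflat : ∀ᶠ y in 𝓝 x₀, ∀ u v w, fderiv ℝ A y v u w + A y u (A y v w) =
      fderiv ℝ A y u v w + A y v (A y u w)) (w₀ : W) :
    ∃ F : E → W, F x₀ = w₀ ∧ ∀ᶠ y in 𝓝 x₀, HasFDerivAt F ((A y).flip (F y)) y := by
  obtain ⟨δ, C, hb⟩ := exists_connectionBounds hA hflat
  have hex (x : E) : ∃ α : ℝ → W, ‖x - x₀‖ < δ → α 0 = w₀ ∧
      (∀ t ∈ Icc (0 : ℝ) 1,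
        HasDerivWithinAt α (A (x₀ + t • (x - x₀)) (x - x₀) (α t)) (Icc 0 1) t) ∧
      ∀ t ∈ Icc (0 : ℝ) 1, ‖α t‖ ≤ ‖w₀‖ * Real.exp 1 := by
    by_cases h : ‖x - x₀‖ < δ
    · obtain ⟨α, hα⟩ := hb.exists_transport w₀ h
      exact ⟨α, fun _ => hα⟩
    · exact ⟨0, fun h' => absurd h' h⟩
  choose α hα using hex
  refine ⟨fun x => α x 1, ?_, ?_⟩
  · obtain ⟨h0, h1, -⟩ := hα x₀ (by simpa using hb.pos)
    have := constant_of_derivWithin_zero (f := α x₀) (a := 0) (b := 1)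
      (fun t ht => (h1 t ht).differentiableWithinAt) (fun t ht => by
        have hu := (uniqueDiffOn_Icc (zero_lt_one' ℝ)) t (Ico_subset_Icc_self ht)
        simpa using (h1 t (Ico_subset_Icc_self ht)).derivWithin hu) 1 (by simp)
    exact this.trans h0
  · filter_upwards [Metric.ball_mem_nhds x₀ hb.pos] with x hx
    rw [mem_ball_iff_norm] at hx
    obtain ⟨a0, a1, a2⟩ := hα x hx
    rw [hasFDerivAt_iff_isLittleO_nhds_zero]
    refine Asymptotics.IsBigO.trans_isLittleO (g := fun k : E => ‖k‖ ^ 2) ?_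
      (by simpa using Asymptotics.isLittleO_norm_pow_id (E' := E) one_lt_two)
    refine Asymptotics.IsBigO.of_bound
      ((2 * C + 2 * C ^ 2) * (‖w₀‖ * Real.exp 1) * (Real.exp 1 - 1)) ?_
    have hev : ∀ᶠ k : E in 𝓝 0, ‖x - x₀ + k‖ < δ := by
      have : ContinuousAt (fun k : E => ‖x - x₀ + k‖) 0 := by fun_prop
      exact this.eventually_lt_const (by simpa using hx)
    filter_upwards [hev] with k hk
    have he : x + k - x₀ = x - x₀ + k := by abel
    obtain ⟨b0, b1, -⟩ := hα (x + k) (by rwa [he])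
    rw [he] at b1
    have := hb.transport_sub_le hx hk (a0.trans b0.symm) a1 b1 a2
    simpa using this

theorem contDiffOn_of_parallel {A : E → E →L[ℝ] W →L[ℝ] W} {s : Set E} (hs : IsOpen s)
    (hA : ContDiffOn ℝ ∞ A s) {F : E → W} (hF : ∀ y ∈ s, HasFDerivAt F ((A y).flip (F y)) y) :
    ContDiffOn ℝ ∞ F s := by
  rw [contDiffOn_infty]
  intro n
  induction n with
  | zero =>
    exact contDiffOn_zero.2 fun y hy => (hF y hy).continuousAt.continuousWithinAt
  | succ n ih =>
    push_cast
    rw [contDiffOn_succ_iff_fderiv_of_isOpen hs]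
    refine ⟨fun y hy => (hF y hy).differentiableAt.differentiableWithinAt, by simp, ?_⟩
    have h1 : ContDiffOn ℝ n (fun y => (A y).flip (F y)) s :=
      ((ContinuousLinearMap.flipₗᵢ ℝ E W W).contDiff.comp_contDiffOn
        (hA.of_le (by exact_mod_cast le_top))).clm_apply ih
    exact h1.congr fun y hy => (hF y hy).fderiv

end Frobenius

section Hyperbolic

variable {E : Type*} [NormedAddCommGroup E] [NormedSpace ℝ E]
  {G : E → E →L[ℝ] E →L[ℝ] ℝ} {x : E}

/-- The connection form on `ℝ ⊕ TE` whose parallel sections `(β, n)` satisfy `n = ∇β` and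
`∇²β = β G`. -/
def hessianConnection (G : E → E →L[ℝ] E →L[ℝ] ℝ) (x : E) :
    E →L[ℝ] (ℝ × E) →L[ℝ] (ℝ × E) :=
  (((ContinuousLinearMap.compL ℝ (ℝ × E) ℝ (ℝ × E)) (ContinuousLinearMap.inl ℝ ℝ E)).comp
    ((ContinuousLinearMap.compL ℝ (ℝ × E) E ℝ).flip (ContinuousLinearMap.snd ℝ ℝ E))).comp (G x) +
  (((ContinuousLinearMap.compL ℝ (ℝ × E) E (ℝ × E)) (ContinuousLinearMap.inr ℝ ℝ E)).comp
    ((ContinuousLinearMap.compL ℝ (ℝ × E) ℝ E).flip (ContinuousLinearMap.fst ℝ ℝ E))).comp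
      (ContinuousLinearMap.lsmul ℝ ℝ).flip -
  (((ContinuousLinearMap.compL ℝ (ℝ × E) E (ℝ × E)) (ContinuousLinearMap.inr ℝ ℝ E)).comp
    ((ContinuousLinearMap.compL ℝ (ℝ × E) E E).flip (ContinuousLinearMap.snd ℝ ℝ E))).comp
      (christoffelCLM G x)

theorem hessianConnection_apply (G : E → E →L[ℝ] E →L[ℝ] ℝ) (x u : E) (w : ℝ × E) :
    hessianConnection G x u w = (G x u w.2, w.1 • u - christoffelCLM G x u w.2) := by
  simp [hessianConnection]

theorem contDiffAt_hessianConnection [CompleteSpace E] (h : IsMetricAt G x) :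
    ContDiffAt ℝ ∞ (hessianConnection G) x :=
  ((contDiffAt_const.clm_comp h.smooth).add contDiffAt_const).sub
    (contDiffAt_const.clm_comp (contDiffAt_christoffelCLM h))

theorem fderiv_hessianConnection [CompleteSpace E] (h : IsMetricAt G x) (v u : E) (w : ℝ × E) :
    fderiv ℝ (hessianConnection G) x v u w =
      (fderiv ℝ G x v u w.2, - fderiv ℝ (christoffelCLM G) x v u w.2) := by
  have dG := h.smooth.differentiableAt (by simp)
  have dΓ := (contDiffAt_christoffelCLM h).differentiableAt (by simp)
  rw [fderiv_clm_apply₂ ((contDiffAt_hessianConnection h).differentiableAt (by simp))]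
  simp only [hessianConnection_apply]
  have c (a : E) := hasFDerivAt_const (𝕜 := ℝ) a x
  have e := ((dG.hasFDerivAt.clm_apply (c u)).clm_apply (c w.2)).prodMk
    ((hasFDerivAt_const (w.1 • u) x).sub ((dΓ.hasFDerivAt.clm_apply (c u)).clm_apply (c w.2)))
  refine (DFunLike.congr_fun e.fderiv v).trans ?_
  simp

theorem hessianConnection_flat [CompleteSpace E] (h : ∀ᶠ y in 𝓝 x, IsMetricAt G y)
    (hcurv : ∀ u v w, coordCurvature G x u v w = (-1 : ℝ) • (G x v w • u - G x u w • v))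
    (u v : E) (w : ℝ × E) :
    fderiv ℝ (hessianConnection G) x v u w +
        hessianConnection G x u (hessianConnection G x v w) =
      fderiv ℝ (hessianConnection G) x u v w +
        hessianConnection G x v (hessianConnection G x u w) := by
  have hm := h.self_of_nhds
  have dΓ := (contDiffAt_christoffelCLM hm).differentiableAt (by simp)
  have hc := hcurv u v w.2
  rw [coordCurvature_eq dΓ, ← sub_eq_zero] at hc
  simp only [hessianConnection_apply, fderiv_hessianConnection hm, Prod.mk_add_mk, Prod.mk.injEq]
  constructor
  · simp only [fderiv_form h, map_sub, map_smul, smul_eq_mul, christoffel_symm h v u,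
      hm.symm v u]
    ring
  · rw [← sub_eq_zero, ← hc]
    simp only [map_sub, map_smul, christoffel_symm h v u]
    module

/-- `⟨∇β, ∇β'⟩ - ββ'` is constant for solutions of `∇²β = β G`. -/
theorem hasFDerivAt_hessian_pairing (h : ∀ᶠ y in 𝓝 x, IsMetricAt G y) {F F' : E → ℝ × E}
    (hF : HasFDerivAt F ((hessianConnection G x).flip (F x)) x)
    (hF' : HasFDerivAt F' ((hessianConnection G x).flip (F' x)) x) :
    HasFDerivAt (fun y => G y (F y).2 (F' y).2 - (F y).1 * (F' y).1) (0 : E →L[ℝ] ℝ) x := by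
  have hm := h.self_of_nhds
  have dG := (hm.smooth.differentiableAt (by simp)).hasFDerivAt
  have e := ((dG.clm_apply hF.snd).clm_apply hF'.snd).sub (hF.fst.mul hF'.fst)
  refine e.congr_fderiv (ContinuousLinearMap.ext fun u => ?_)
  simp only [add_apply, sub_apply, ContinuousLinearMap.comp_apply,
    ContinuousLinearMap.flip_apply, smul_apply, smul_eq_mul, zero_apply,
    hessianConnection_apply, ContinuousLinearMap.coe_fst', ContinuousLinearMap.coe_snd',
    fderiv_form h, map_sub, map_smul, hm.symm u]
  ring

theorem form_eq_of_orthonormal (hm : IsMetricAt G x) (hE : Module.finrank ℝ E = 2) {a b : E}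
    (ha : G x a a = 1) (hb : G x b b = 1) (hab : G x a b = 0) (u v : E) :
    G x u v = G x a u * G x a v + G x b u * G x b v := by
  have hli : LinearIndependent ℝ ![a, b] := by
    rw [LinearIndependent.pair_iff]
    intro s t hst
    have h1 := congrArg (fun z => G x a z) hst
    have h2 := congrArg (fun z => G x b z) hst
    simp only [map_add, map_smul, smul_eq_mul, map_zero, ha, hb, hab, hm.symm b a] at h1 h2
    constructor <;> linarith
  let e := basisOfLinearIndependentOfCardEqFinrank hli (by simp [hE])
  have hexp (z : E) : ∃ c d : ℝ, z = c • a + d • b := by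
    refine ⟨e.repr z 0, e.repr z 1, ?_⟩
    conv_lhs => rw [← e.sum_repr z, Fin.sum_univ_two]
    simp [e]
  obtain ⟨c, d, rfl⟩ := hexp u
  obtain ⟨c', d', rfl⟩ := hexp v
  simp only [map_add, map_smul, add_apply, smul_apply, smul_eq_mul, ha, hb, hab, hm.symm b a]
  ring

theorem exists_orthonormal_pair (hpos : ∀ v, v ≠ 0 → 0 < G x v v)
    (hE : Module.finrank ℝ E = 2) : ∃ a b, G x a a = 1 ∧ G x b b = 1 ∧ G x a b = 0 := by
  have : FiniteDimensional ℝ E := FiniteDimensional.of_finrank_pos (by omega)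
  let e := Module.finBasisOfFinrankEq ℝ E hE
  have hnorm (v : E) (hv : v ≠ 0) : G x ((√(G x v v))⁻¹ • v) ((√(G x v v))⁻¹ • v) = 1 := by
    have h0 := hpos v hv
    have h1 := Real.sq_sqrt h0.le
    have h2 : √(G x v v) ≠ 0 := (Real.sqrt_pos.2 h0).ne'
    simp only [map_smul, smul_apply, smul_eq_mul]
    field_simp
    exact h1.symm
  set b := e 1 - (G x (e 0) (e 1) / G x (e 0) (e 0)) • e 0 with hb
  have hb0 : b ≠ 0 := by
    intro h
    have := congrArg (fun z => e.repr z 1) h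
    simp [hb] at this
  have h00 := hpos _ (e.ne_zero 0)
  refine ⟨_, _, hnorm _ (e.ne_zero 0), hnorm b hb0, ?_⟩
  have : G x (e 0) b = 0 := by
    simp only [hb, map_sub, map_smul, smul_eq_mul]
    field_simp
    simp
  simp [this]

/-- Local half-plane coordinates on a surface of curvature `-1`. -/
theorem exists_halfPlane_coordinates [CompleteSpace E] (hE : Module.finrank ℝ E = 2)
    (h : ∀ᶠ y in 𝓝 x, IsMetricAt G y) (hpos : ∀ v, v ≠ 0 → 0 < G x v v)
    (hcurv : ∀ᶠ y in 𝓝 x, ∀ u v w,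
      coordCurvature G y u v w = (-1 : ℝ) • (G y v w • u - G y u w • v)) :
    ∃ s : Set E, IsOpen s ∧ x ∈ s ∧ ∃ X Y : E → ℝ, ContDiffOn ℝ ∞ X s ∧ ContDiffOn ℝ ∞ Y s ∧
      ∀ y ∈ s, 0 < Y y ∧ ∀ u v, fderiv ℝ X y u * fderiv ℝ X y v + fderiv ℝ Y y u * fderiv ℝ Y y v =
        Y y ^ 2 * G y u v := by
  obtain ⟨a, b, ha, hb, hab⟩ := exists_orthonormal_pair hpos hE
  have hA : ∀ᶠ y in 𝓝 x, ContDiffAt ℝ ∞ (hessianConnection G) y :=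
    h.mono fun y hy => contDiffAt_hessianConnection hy
  have hflat : ∀ᶠ y in 𝓝 x, ∀ u v w, fderiv ℝ (hessianConnection G) y v u w +
        hessianConnection G y u (hessianConnection G y v w) =
      fderiv ℝ (hessianConnection G) y u v w +
        hessianConnection G y v (hessianConnection G y u w) := by
    filter_upwards [h.eventually_nhds, hcurv] with y h1 h2
    exact fun u v w => hessianConnection_flat h1 h2 u v w
  obtain ⟨P, hPx, hP⟩ := exists_parallel_section hA hflat ((1 : ℝ), a)
  obtain ⟨Q, hQx, hQ⟩ := exists_parallel_section hA hflat ((0 : ℝ), b)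
  have hP1 : ∀ᶠ y in 𝓝 x, 0 < (P y).1 :=
    (hP.self_of_nhds.continuousAt.fst).eventually_const_lt (by simp [hPx])
  obtain ⟨r, hr, hball⟩ := Metric.eventually_nhds_iff_ball.1
    (h.eventually_nhds.and (hP.and (hQ.and (hP1.and hA))))
  have hx : x ∈ Metric.ball x r := Metric.mem_ball_self hr
  have hconst (F F' : E → ℝ × E)
      (hF : ∀ y ∈ Metric.ball x r, HasFDerivAt F ((hessianConnection G y).flip (F y)) y)
      (hF' : ∀ y ∈ Metric.ball x r, HasFDerivAt F' ((hessianConnection G y).flip (F' y)) y)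
      (y : E) (hy : y ∈ Metric.ball x r) : G y (F y).2 (F' y).2 - (F y).1 * (F' y).1 =
        G x (F x).2 (F' x).2 - (F x).1 * (F' x).1 := by
    have hd (z : E) (hz : z ∈ Metric.ball x r) :=
      hasFDerivAt_hessian_pairing (hball z hz).1 (hF z hz) (hF' z hz)
    exact Metric.isOpen_ball.is_const_of_fderiv_eq_zero
      (convex_ball x r).isPreconnected
      (fun z hz => (hd z hz).differentiableAt.differentiableWithinAt)
      (fun z hz => (hd z hz).fderiv) hy hx
  have hsP : ContDiffOn ℝ ∞ P (Metric.ball x r) := contDiffOn_of_parallel Metric.isOpen_ball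
    (fun y hy => (hball y hy).2.2.2.2.contDiffWithinAt) fun y hy => (hball y hy).2.1
  have hsQ : ContDiffOn ℝ ∞ Q (Metric.ball x r) := contDiffOn_of_parallel Metric.isOpen_ball
    (fun y hy => (hball y hy).2.2.2.2.contDiffWithinAt) fun y hy => (hball y hy).2.2.1
  refine ⟨Metric.ball x r, Metric.isOpen_ball, hx, fun y => (Q y).1 * ((P y).1)⁻¹,
    fun y => ((P y).1)⁻¹, hsQ.fst.mul (hsP.fst.inv fun y hy => (hball y hy).2.2.2.1.ne'),
    hsP.fst.inv fun y hy => (hball y hy).2.2.2.1.ne', fun y hy => ?_⟩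
  obtain ⟨hm, dP, dQ, hβ, -⟩ := hball y hy
  refine ⟨inv_pos.2 hβ, fun u v => ?_⟩
  have k1 := hconst P P (fun z hz => (hball z hz).2.1) (fun z hz => (hball z hz).2.1) y hy
  have k2 := hconst P Q (fun z hz => (hball z hz).2.1) (fun z hz => (hball z hz).2.2.1) y hy
  have k3 := hconst Q Q (fun z hz => (hball z hz).2.2.1) (fun z hz => (hball z hz).2.2.1) y hy
  simp only [hPx, hQx, ha, hb, hab] at k1 k2 k3
  set β := (P y).1
  set β' := (Q y).1
  set n := (P y).2
  set n' := (Q y).2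
  have hm' := hm.self_of_nhds
  have hβ0 : β ≠ 0 := hβ.ne'
  have o := form_eq_of_orthonormal hm' hE (a := β⁻¹ • n) (b := n' - (β' / β) • n)
    (by simp only [map_smul, smul_apply, smul_eq_mul]; field_simp; linarith)
    (by
      simp only [map_smul, map_sub, sub_apply, smul_apply, smul_eq_mul, hm'.symm n' n]
      field_simp
      linear_combination β ^ 2 * k3 - 2 * β * β' * k2 + β' ^ 2 * k1)
    (by
      simp only [map_smul, map_sub, smul_apply, smul_eq_mul]
      field_simp
      linear_combination β * k2 - β' * k1) u v
  have e := (hasDerivAt_inv hβ0).comp_hasFDerivAt y dP.fst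
  have eY (w : E) : fderiv ℝ (fun y => ((P y).1)⁻¹) y w = - G y n w / β ^ 2 := by
    refine (DFunLike.congr_fun e.fderiv w).trans ?_
    simp only [smul_apply, ContinuousLinearMap.comp_apply, ContinuousLinearMap.flip_apply,
      hessianConnection_apply, ContinuousLinearMap.coe_fst', smul_eq_mul, hm'.symm w]
    simp only [β, n]
    ring
  have eX (w : E) : fderiv ℝ (fun y => (Q y).1 * ((P y).1)⁻¹) y w =
      (β * G y n' w - β' * G y n w) / β ^ 2 := by
    refine (DFunLike.congr_fun (dQ.fst.mul e).fderiv w).trans ?_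
    simp only [smul_apply, add_apply, Function.comp_apply, ContinuousLinearMap.comp_apply,
      ContinuousLinearMap.flip_apply,
      hessianConnection_apply, ContinuousLinearMap.coe_fst', smul_eq_mul, hm'.symm w]
    change β' * (-(β ^ 2)⁻¹ * G y n w) + β⁻¹ * G y n' w = _
    field_simp
    ring
  change _ = (β⁻¹) ^ 2 * G y u v
  rw [eX, eX, eY, eY, o]
  simp only [map_smul, map_sub, sub_apply, smul_apply, smul_eq_mul]
  field_simp
  ring

end Hyperbolic

section Manifold

variable {E : Type*} [NormedAddCommGroup E] [NormedSpace ℝ E] {H : Type*} [TopologicalSpace H]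
  {I : ModelWithCorners ℝ E H} {M : Type*} [TopologicalSpace M] [ChartedSpace H M]

theorem isInvertible_of_injective [FiniteDimensional ℝ E] {B : E →L[ℝ] E →L[ℝ] ℝ}
    (h : Function.Injective B) : B.IsInvertible := by
  have e : (E →L[ℝ] ℝ) ≃ₗ[ℝ] (E →ₗ[ℝ] ℝ) := LinearMap.toContinuousLinearMap.symm
  have hr : Module.finrank ℝ E = Module.finrank ℝ (E →L[ℝ] ℝ) := by
    exact (e.finrank_eq.trans Subspace.dual_finrank_eq).symm
  exact ⟨(LinearEquiv.ofInjectiveOfFinrankEq (B : E →ₗ[ℝ] E →L[ℝ] ℝ) h hr).toContinuousLinearEquiv,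
    ContinuousLinearMap.ext fun _ => rfl⟩

theorem isMetricAt_of_pos [FiniteDimensional ℝ E] {G : E → E →L[ℝ] E →L[ℝ] ℝ} {x : E}
    (hs : ContDiffAt ℝ ∞ G x) (hsymm : ∀ u v, G x u v = G x v u)
    (hpos : ∀ v, v ≠ 0 → 0 < G x v v) : IsMetricAt G x := by
  refine ⟨hs, hsymm, isInvertible_of_injective ?_⟩
  rw [injective_iff_map_eq_zero]
  intro v hv
  by_contra h
  simpa [hv] using hpos v h

theorem chartForm_apply (g : FormField I M) (p : M) (y u v : E) :
    chartForm I g p y u v = g ((extChartAt I p).symm y)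
      (mfderiv 𝓘(ℝ, E) I (extChartAt I p).symm y u)
      (mfderiv 𝓘(ℝ, E) I (extChartAt I p).symm y v) := rfl

/-- The change of coordinates from the preferred chart at `q` to that at `p`. -/
def transition (I : ModelWithCorners ℝ E H) (p q : M) : E → E :=
  extChartAt I p ∘ (extChartAt I q).symm

theorem transition_self {p q : M} :
    transition I p q (extChartAt I q q) = extChartAt I p q := by
  simp [transition]

theorem eventually_mem_transition [I.Boundaryless] {p q : M} (hq : q ∈ (extChartAt I p).source) :
    ∀ᶠ y in 𝓝 (extChartAt I q q),
      y ∈ (extChartAt I q).target ∧ (extChartAt I q).symm y ∈ (extChartAt I p).source := by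
  refine ((isOpen_extChartAt_target q).eventually_mem (mem_extChartAt_target q)).and ?_
  refine (continuousAt_extChartAt_symm q).eventually ?_
  rw [extChartAt_to_inv]
  exact (isOpen_extChartAt_source p).eventually_mem hq

variable [I.Boundaryless] [IsManifold I ∞ M]

theorem mdifferentiableAt_chart_symm {p : M} {y : E} (hy : y ∈ (extChartAt I p).target) :
    MDifferentiableAt 𝓘(ℝ, E) I (extChartAt I p).symm y := by
  have : IsManifold I 1 M := .of_le (n := ∞) (by simp)
  have := mdifferentiableWithinAt_extChartAt_symm hy
  rwa [I.range_eq_univ, mdifferentiableWithinAt_univ] at this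

theorem mfderiv_chart_comp_symm {p : M} {y : E} (hy : y ∈ (extChartAt I p).target) (u : E) :
    mfderiv I 𝓘(ℝ, E) (extChartAt I p) ((extChartAt I p).symm y)
      (mfderiv 𝓘(ℝ, E) I (extChartAt I p).symm y u) = u := by
  have : IsManifold I 1 M := .of_le (n := ∞) (by simp)
  have := mfderiv_extChartAt_comp_mfderivWithin_extChartAt_symm hy
  rw [I.range_eq_univ, mfderivWithin_univ] at this
  exact DFunLike.congr_fun this u

theorem mfderiv_chart_symm_comp {p : M} {y : E} (hy : y ∈ (extChartAt I p).target)
    (u : TangentSpace I ((extChartAt I p).symm y)) :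
    mfderiv 𝓘(ℝ, E) I (extChartAt I p).symm y
      (mfderiv I 𝓘(ℝ, E) (extChartAt I p) ((extChartAt I p).symm y) u) = u := by
  have : IsManifold I 1 M := .of_le (n := ∞) (by simp)
  have := mfderivWithin_extChartAt_symm_comp_mfderiv_extChartAt hy
  rw [I.range_eq_univ, mfderivWithin_univ] at this
  exact DFunLike.congr_fun this u

theorem mfderiv_chart_symm_injective {p : M} {y : E} (hy : y ∈ (extChartAt I p).target) :
    Function.Injective (mfderiv 𝓘(ℝ, E) I (extChartAt I p).symm y) := by
  intro u v huv
  have := mfderiv_chart_comp_symm hy u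
  rw [huv] at this
  exact this.symm.trans (mfderiv_chart_comp_symm hy v)

theorem mfderiv_chart_symm_self (p : M) (u : E) :
    (mfderiv 𝓘(ℝ, E) I (extChartAt I p).symm (extChartAt I p p) u : E) = u := by
  have : IsManifold I 1 M := .of_le (n := ∞) (by simp)
  have := mfderivWithin_range_extChartAt_symm (I := I) (x := p)
  rw [I.range_eq_univ, mfderivWithin_univ] at this
  exact DFunLike.congr_fun this u

theorem chartForm_self (g : FormField I M) (p : M) (u v : E) :
    chartForm I g p (extChartAt I p p) u v = g p u v := by
  have key (q : M) (hq : q = p) (a b : TangentSpace I q) (ha : (a : E) = u) (hb : (b : E) = v) :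
      g q a b = g p u v := by
    subst hq
    subst ha
    subst hb
    rfl
  exact key _ (extChartAt_to_inv p) _ _ (mfderiv_chart_symm_self p u) (mfderiv_chart_symm_self p v)

theorem contMDiffOn_chart_field (p : M) (u : E) : ContMDiffOn 𝓘(ℝ, E) I.tangent ∞
      (fun y : E => (Bundle.TotalSpace.mk' E ((extChartAt I p).symm y)
        (mfderiv 𝓘(ℝ, E) I (extChartAt I p).symm y u) : TangentBundle I M))
      (extChartAt I p).target := by
  have hopen : IsOpen (extChartAt I p).target := isOpen_extChartAt_target p
  have hsymm : ContMDiffOn 𝓘(ℝ, E) I ∞ (extChartAt I p).symm (extChartAt I p).target :=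
    contMDiffOn_extChartAt_symm p
  have h2 : ContMDiff 𝓘(ℝ, E) 𝓘(ℝ, E).tangent ∞
      (fun y : E => (⟨y, u⟩ : TangentBundle 𝓘(ℝ, E) E)) :=
    contMDiff_vectorSpace_iff_contDiff.2 contDiff_const
  have h1 := hsymm.contMDiffOn_tangentMapWithin (m := ∞) (by simp) hopen.uniqueMDiffOn
  generalize hT : tangentMapWithin 𝓘(ℝ, E) I (extChartAt I p).symm (extChartAt I p).target = T at h1
  have h3 := h1.comp h2.contMDiffOn (fun y (hy : y ∈ (extChartAt I p).target) => hy)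
  have h4 (y : E) (hy : y ∈ (extChartAt I p).target) :
      (Bundle.TotalSpace.mk' E ((extChartAt I p).symm y)
      (mfderiv 𝓘(ℝ, E) I (extChartAt I p).symm y u) : TangentBundle I M) = T ⟨y, u⟩ := by
    subst hT
    rw [← mfderivWithin_of_isOpen (I := 𝓘(ℝ, E)) (I' := I) hopen hy]
    rfl
  exact h3.congr h4

theorem contDiffOn_chartForm [FiniteDimensional ℝ E] {g : FormField I M}
    (hg : ContMDiff I (I.prod 𝓘(ℝ, E →L[ℝ] E →L[ℝ] ℝ)) ∞
      (fun b => Bundle.TotalSpace.mk' (E →L[ℝ] E →L[ℝ] ℝ)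
        (E := fun x : M => TangentSpace I x →L[ℝ] TangentSpace I x →L[ℝ] ℝ) b (g b))) (p : M) :
    ContDiffOn ℝ ∞ (chartForm I g p) (extChartAt I p).target := by
  have hopen : IsOpen (extChartAt I p).target := isOpen_extChartAt_target p
  have hsymm : ContMDiffOn 𝓘(ℝ, E) I ∞ (extChartAt I p).symm (extChartAt I p).target :=
    contMDiffOn_extChartAt_symm p
  have hsec (u : E) := contMDiffOn_chart_field (I := I) p u
  refine contDiffOn_clm_apply.2 fun u => contDiffOn_clm_apply.2 fun v => ?_
  rw [← contMDiffOn_iff_contDiffOn]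
  intro y hy
  have : ContMDiffWithinAt 𝓘(ℝ, E) (I.prod 𝓘(ℝ)) ∞
      (fun m ↦ Bundle.TotalSpace.mk' ℝ (E := Bundle.Trivial M ℝ) ((extChartAt I p).symm m)
        (g ((extChartAt I p).symm m) (mfderiv 𝓘(ℝ, E) I (extChartAt I p).symm m u)
          (mfderiv 𝓘(ℝ, E) I (extChartAt I p).symm m v))) (extChartAt I p).target y := by
    apply ContMDiffWithinAt.clm_bundle_apply₂ (F₁ := E) (F₂ := E)
    · exact ContMDiffAt.comp_contMDiffWithinAt y hg.contMDiffAt (hsymm y hy)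
    · exact hsec u y hy
    · exact hsec v y hy
  simp only [Bundle.contMDiffWithinAt_totalSpace] at this
  exact this.2

theorem isMetricAt_chartForm [FiniteDimensional ℝ E] {g : FormField I M}
    (hg : ContMDiff I (I.prod 𝓘(ℝ, E →L[ℝ] E →L[ℝ] ℝ)) ∞
      (fun b => Bundle.TotalSpace.mk' (E →L[ℝ] E →L[ℝ] ℝ)
        (E := fun x : M => TangentSpace I x →L[ℝ] TangentSpace I x →L[ℝ] ℝ) b (g b)))
    (hsymm : ∀ x v w, g x v w = g x w v) (hpos : ∀ x v, v ≠ 0 → 0 < g x v v) {p : M} {y : E}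
    (hy : y ∈ (extChartAt I p).target) : IsMetricAt (chartForm I g p) y := by
  refine isMetricAt_of_pos ((contDiffOn_chartForm hg p).contDiffAt
    ((isOpen_extChartAt_target p).mem_nhds hy)) (fun u v => ?_) fun v hv => ?_
  · rw [chartForm_apply, chartForm_apply, hsymm]
  · rw [chartForm_apply]
    refine hpos _ _ fun h => hv (mfderiv_chart_symm_injective hy ?_)
    exact h.trans (ContinuousLinearMap.map_zero _).symm

theorem contDiffAt_transition {p q : M} {y : E} (hy : y ∈ (extChartAt I q).target)
    (hy' : (extChartAt I q).symm y ∈ (extChartAt I p).source) :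
    ContDiffAt ℝ ∞ (transition I p q) y := by
  rw [← contMDiffAt_iff_contDiffAt]
  refine ContMDiffAt.comp y ?_ ((contMDiffOn_extChartAt_symm q).contMDiffAt
    ((isOpen_extChartAt_target q).mem_nhds hy))
  exact contMDiffAt_extChartAt' (by simpa using hy')

theorem fderiv_transition {p q : M} {y : E} (hy : y ∈ (extChartAt I q).target)
    (hy' : (extChartAt I q).symm y ∈ (extChartAt I p).source) (u : E) :
    (fderiv ℝ (transition I p q) y u : E) =
      mfderiv I 𝓘(ℝ, E) (extChartAt I p) ((extChartAt I q).symm y)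
        (mfderiv 𝓘(ℝ, E) I (extChartAt I q).symm y u) := by
  have : IsManifold I 1 M := .of_le (n := ∞) (by simp)
  rw [← mfderiv_eq_fderiv]
  exact mfderiv_comp_apply y (mdifferentiableAt_extChartAt (by simpa using hy'))
    (mdifferentiableAt_chart_symm hy) u

theorem fderiv_transition_injective {p q : M} {y : E} (hy : y ∈ (extChartAt I q).target)
    (hy' : (extChartAt I q).symm y ∈ (extChartAt I p).source) :
    Function.Injective (fderiv ℝ (transition I p q) y) := by
  have : IsManifold I 1 M := .of_le (n := ∞) (by simp)
  intro u v huv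
  rw [fderiv_transition hy hy', fderiv_transition hy hy'] at huv
  exact mfderiv_chart_symm_injective hy ((isInvertible_mfderiv_extChartAt hy').injective huv)

theorem chartForm_transition (g : FormField I M) {p q : M} {y : E}
    (hy : y ∈ (extChartAt I q).target)
    (hy' : (extChartAt I q).symm y ∈ (extChartAt I p).source) (u v : E) :
    chartForm I g q y u v = chartForm I g p (transition I p q y)
      (fderiv ℝ (transition I p q) y u) (fderiv ℝ (transition I p q) y v) := by
  have hz : transition I p q y ∈ (extChartAt I p).target := (extChartAt I p).map_source hy'
  have hinv : (extChartAt I p).symm (transition I p q y) = (extChartAt I q).symm y :=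
    (extChartAt I p).left_inv hy'
  have key (w : E) : (mfderiv 𝓘(ℝ, E) I (extChartAt I p).symm (transition I p q y)
      (fderiv ℝ (transition I p q) y w) : E) = mfderiv 𝓘(ℝ, E) I (extChartAt I q).symm y w := by
    rw [fderiv_transition hy hy']
    have h1 (x : M) (hx : x = (extChartAt I q).symm y) (a : TangentSpace I x)
        (b : TangentSpace I ((extChartAt I q).symm y)) (hab : (a : E) = b) :
        (mfderiv I 𝓘(ℝ, E) (extChartAt I p) x a : E) =
          mfderiv I 𝓘(ℝ, E) (extChartAt I p) ((extChartAt I q).symm y) b := by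
      subst hx
      subst hab
      rfl
    rw [← h1 _ hinv (mfderiv 𝓘(ℝ, E) I (extChartAt I q).symm y w : E) _ rfl]
    exact mfderiv_chart_symm_comp hz _
  have h2 (x x' : M) (hx : x = x') (a b : TangentSpace I x) (a' b' : TangentSpace I x')
      (ha : (a : E) = a') (hb : (b : E) = b') : g x a b = g x' a' b' := by
    subst hx
    subst ha
    subst hb
    rfl
  exact (h2 _ _ hinv _ _ _ _ (key u) (key v)).symm

end Manifold

section Sphere

open scoped InnerProductSpace

theorem contMDiff_coe_S2 : ContMDiff (𝓡 2) 𝓘(ℝ, E3) ∞ (Subtype.val : S2 → E3) :=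
  have := Fact.mk (@finrank_euclideanSpace_fin ℝ _ (2 + 1))
  contMDiff_coe_sphere (n := 2) (E := E3)

theorem mfderiv_coe_S2_injective (p : S2) :
    Function.Injective (mfderiv (𝓡 2) 𝓘(ℝ, E3) (Subtype.val : S2 → E3) p) :=
  have := Fact.mk (@finrank_euclideanSpace_fin ℝ _ (2 + 1))
  injective_mvfderiv_subtypeVal_sphere (n := 2) (E := E3) p

theorem exists_mfderiv_coe_S2_eq {p : S2} {z : E3} (hz : ⟪z, (p : E3)⟫_ℝ = 0) :
    ∃ t : TangentSpace (𝓡 2) p, (mfderiv (𝓡 2) 𝓘(ℝ, E3) (Subtype.val : S2 → E3) p t : E3) = z := by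
  have := Fact.mk (@finrank_euclideanSpace_fin ℝ _ (2 + 1))
  have hr := range_mvfderiv_subtypeVal (n := 2) (E := E3) p
  have hmem : z ∈ (ℝ ∙ (p : E3))ᗮ := Submodule.mem_orthogonal_singleton_iff_inner_left.2 hz
  rw [← hr] at hmem
  exact hmem

/-- The inclusion of the sphere in the preferred chart at `a`. -/
def sphereEmb (a : S2) (y : E2) : E3 := ((extChartAt (𝓡 2) a).symm y : S2)

theorem contDiffAt_sphereEmb {a : S2} {y : E2} (hy : y ∈ (extChartAt (𝓡 2) a).target) :
    ContDiffAt ℝ ∞ (sphereEmb a) y := by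
  rw [← contMDiffAt_iff_contDiffAt]
  exact ContMDiffAt.comp y contMDiff_coe_S2.contMDiffAt
    ((contMDiffOn_extChartAt_symm a).contMDiffAt ((isOpen_extChartAt_target a).mem_nhds hy))

theorem norm_sphereEmb (a : S2) (y : E2) : ‖sphereEmb a y‖ = 1 := by
  simp [sphereEmb]

theorem fderiv_sphereEmb {a : S2} {y : E2} (hy : y ∈ (extChartAt (𝓡 2) a).target) (u : E2) :
    (fderiv ℝ (sphereEmb a) y u : E3) =
      mfderiv (𝓡 2) 𝓘(ℝ, E3) (Subtype.val : S2 → E3) ((extChartAt (𝓡 2) a).symm y)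
        (mfderiv 𝓘(ℝ, E2) (𝓡 2) (extChartAt (𝓡 2) a).symm y u) := by
  rw [← mfderiv_eq_fderiv]
  exact mfderiv_comp_apply y
    (contMDiff_coe_S2.contMDiffAt.mdifferentiableAt (by simp))
    (mdifferentiableAt_chart_symm hy) u

theorem fderiv_sphereEmb_injective {a : S2} {y : E2} (hy : y ∈ (extChartAt (𝓡 2) a).target) :
    Function.Injective (fderiv ℝ (sphereEmb a) y) := by
  intro u v huv
  rw [fderiv_sphereEmb hy, fderiv_sphereEmb hy] at huv
  exact mfderiv_chart_symm_injective hy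
    (mfderiv_coe_S2_injective _ huv)

theorem eq_zero_of_inner_sphereEmb {a : S2} {y : E2} (hy : y ∈ (extChartAt (𝓡 2) a).target)
    (z : E3) (hz : ∀ u, ⟪z, fderiv ℝ (sphereEmb a) y u⟫_ℝ = 0)
    (hz' : ⟪z, sphereEmb a y⟫_ℝ = 0) : z = 0 := by
  obtain ⟨t, ht⟩ := exists_mfderiv_coe_S2_eq hz'
  have h1 := hz (mfderiv (𝓡 2) 𝓘(ℝ, E2) (extChartAt (𝓡 2) a) ((extChartAt (𝓡 2) a).symm y) t)
  erw [fderiv_sphereEmb hy, mfderiv_chart_symm_comp hy] at h1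
  have h2 : ⟪z, z⟫_ℝ = 0 := by
    conv_lhs => rw [← ht]
    rw [← ht] at h1
    exact h1
  exact inner_self_eq_zero.1 h2

theorem chartForm_roundMetric {a : S2} {y : E2} (hy : y ∈ (extChartAt (𝓡 2) a).target)
    (u v : E2) : chartForm (𝓡 2) roundMetric a y u v =
      ⟪fderiv ℝ (sphereEmb a) y u, fderiv ℝ (sphereEmb a) y v⟫_ℝ := by
  rw [fderiv_sphereEmb hy, fderiv_sphereEmb hy]
  rfl

theorem isMetricAt_chartForm_roundMetric {a : S2} {y : E2}
    (hy : y ∈ (extChartAt (𝓡 2) a).target) : IsMetricAt (chartForm (𝓡 2) roundMetric a) y := by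
  have hopen := (isOpen_extChartAt_target (I := 𝓡 2) a).mem_nhds hy
  have he : chartForm (𝓡 2) roundMetric a =ᶠ[𝓝 y]
      pullbackForm (sphereEmb a) (fun _ => (innerSL ℝ : E3 →L[ℝ] E3 →L[ℝ] ℝ)) :=
    eventuallyEq_pullbackForm (by
      filter_upwards [hopen] with z hz using chartForm_roundMetric hz)
  refine isMetricAt_of_pos
    ((contDiffAt_pullbackForm (contDiffAt_sphereEmb hy) contDiffAt_const).congr_of_eventuallyEq he)
    (fun u v => ?_) fun v hv => ?_
  · rw [chartForm_roundMetric hy, chartForm_roundMetric hy, real_inner_comm]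
  · rw [chartForm_roundMetric hy, real_inner_self_pos]
    exact fun h => hv (fderiv_sphereEmb_injective hy (h.trans (map_zero _).symm))

theorem coordCurvature_roundMetric (a : S2) (u v w : E2) :
    coordCurvature (chartForm (𝓡 2) roundMetric a) (extChartAt (𝓡 2) a a) u v w =
      chartForm (𝓡 2) roundMetric a (extChartAt (𝓡 2) a a) v w • u -
        chartForm (𝓡 2) roundMetric a (extChartAt (𝓡 2) a a) u w • v := by
  have hev := (isOpen_extChartAt_target (I := 𝓡 2) a).eventually_mem (mem_extChartAt_target a)
  exact coordCurvature_of_sphere (Φ := sphereEmb a) (hev.mono fun y hy => contDiffAt_sphereEmb hy)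
    (.of_forall (norm_sphereEmb a)) (hev.mono fun y hy => chartForm_roundMetric hy)
    (hev.mono fun y hy => isMetricAt_chartForm_roundMetric hy)
    (hev.mono fun y hy => eq_zero_of_inner_sphereEmb hy) u v w

end Sphere

section Surface

variable {S : Type*} [TopologicalSpace S] [ChartedSpace E2 S] [IsManifold (𝓡 2) ∞ S]
  (h : Bundle.ContMDiffRiemannianMetric (𝓡 2) ∞ E2 (fun x : S => TangentSpace (𝓡 2) x))

theorem isMetricAt_chartForm_surface {b : S} {y : E2} (hy : y ∈ (extChartAt (𝓡 2) b).target) :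
    IsMetricAt (chartForm (𝓡 2) h.inner b) y :=
  isMetricAt_chartForm h.contMDiff h.symm h.pos hy

variable {h}

theorem coordCurvature_surface_self (hh : HasConstCurvOn (𝓡 2) h.inner (-1) Set.univ)
    (b : S) (u v w : E2) :
    coordCurvature (chartForm (𝓡 2) h.inner b) (extChartAt (𝓡 2) b b) u v w =
      (-1 : ℝ) • (chartForm (𝓡 2) h.inner b (extChartAt (𝓡 2) b b) v w • u -
        chartForm (𝓡 2) h.inner b (extChartAt (𝓡 2) b b) u w • v) := by
  have hev := (isOpen_extChartAt_target (I := 𝓡 2) b).eventually_mem (mem_extChartAt_target b)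
  let e : Module.Basis (Fin 2) ℝ E2 := (EuclideanSpace.basisFun (Fin 2) ℝ).toBasis
  refine coordCurvature_of_sectional (hev.mono fun y hy => isMetricAt_chartForm_surface h hy) e
    ?_ u v w
  have hli : LinearIndependent ℝ ![e 0, e 1] := by
    convert e.linearIndependent
    ext i
    fin_cases i <;> rfl
  have key := hh b (Set.mem_univ b) (e 0) (e 1) hli
  simp only [sectional, curvature] at key
  simp only [chartForm_self]
  have hne : h.inner b (e 0) (e 0) * h.inner b (e 1) (e 1) - h.inner b (e 0) (e 1) ^ 2 ≠ 0 := by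
    intro h0
    rw [h0, div_zero] at key
    norm_num at key
  rwa [div_eq_iff hne] at key

theorem coordCurvature_surface (hh : HasConstCurvOn (𝓡 2) h.inner (-1) Set.univ) {b : S}
    {y : E2} (hy : y ∈ (extChartAt (𝓡 2) b).target)
    (u v w : E2) : coordCurvature (chartForm (𝓡 2) h.inner b) y u v w =
      (-1 : ℝ) • (chartForm (𝓡 2) h.inner b y v w • u - chartForm (𝓡 2) h.inner b y u w • v) := by
  obtain ⟨q, hq, rfl⟩ : ∃ q ∈ (extChartAt (𝓡 2) b).source, extChartAt (𝓡 2) b q = y :=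
    ⟨_, (extChartAt (𝓡 2) b).map_target hy, (extChartAt (𝓡 2) b).right_inv hy⟩
  have hev := eventually_mem_transition (I := 𝓡 2) hq
  have hs : ∀ᶠ y in 𝓝 (extChartAt (𝓡 2) q q),
      Function.Surjective (fderiv ℝ (transition (𝓡 2) b q) y) :=
    hev.mono fun y hy => (LinearMap.injective_iff_surjective (K := ℝ) (V := E2)
      (f := (fderiv ℝ (transition (𝓡 2) b q) y : E2 →ₗ[ℝ] E2))).1
      (fderiv_transition_injective hy.1 hy.2)
  have key (u v w : E2) := fderiv_coordCurvature_of_pullback (Φ := transition (𝓡 2) b q)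
    (G := chartForm (𝓡 2) h.inner b) (G' := chartForm (𝓡 2) h.inner q)
    (x := extChartAt (𝓡 2) q q)
    (hev.mono fun y hy => contDiffAt_transition hy.1 hy.2)
    (by
      rw [transition_self]
      filter_upwards [(isOpen_extChartAt_target (I := 𝓡 2) b).mem_nhds hy] with z hz
        using isMetricAt_chartForm_surface h hz)
    (hev.mono fun y hy => chartForm_transition h.inner hy.1 hy.2)
    (hev.mono fun y hy => isMetricAt_chartForm_surface h hy.1) hs u v w
  obtain ⟨u, rfl⟩ := hs.self_of_nhds u
  obtain ⟨v, rfl⟩ := hs.self_of_nhds v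
  obtain ⟨w, rfl⟩ := hs.self_of_nhds w
  have ht := chartForm_transition h.inner hev.self_of_nhds.1 hev.self_of_nhds.2
  have k := key u v w
  rw [coordCurvature_surface_self hh, ht, ht, transition_self] at k
  rw [← k]
  simp only [map_smul, map_sub]

end Surface

section ProductChart

variable {E : Type*} [NormedAddCommGroup E] [NormedSpace ℝ E] {H : Type*} [TopologicalSpace H]
  {I : ModelWithCorners ℝ E H} {M : Type*} [TopologicalSpace M] [ChartedSpace H M]
  {F : Type*} [NormedAddCommGroup F] [NormedSpace ℝ F] {K : Type*} [TopologicalSpace K]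
  {J : ModelWithCorners ℝ F K} {N : Type*} [TopologicalSpace N] [ChartedSpace K N]

theorem formField_congr (g : FormField I M) {x x' : M} (hx : x = x') {a b : TangentSpace I x}
    {a' b' : TangentSpace I x'} (ha : (a : E) = a') (hb : (b : E) = b') : g x a b = g x' a' b' := by
  subst hx
  subst ha
  subst hb
  rfl

theorem pullback_fst_apply (g : FormField I M) (p : M × N)
    (u v : TangentSpace (I.prod J) p) :
    pullback (I.prod J) I Prod.fst g p u v = g p.1 (u : E × F).1 (v : E × F).1 := by
  simp only [pullback, mfderiv_fst]
  rfl

theorem pullback_snd_apply (g : FormField J N) (p : M × N)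
    (u v : TangentSpace (I.prod J) p) :
    pullback (I.prod J) J Prod.snd g p u v = g p.2 (u : E × F).2 (v : E × F).2 := by
  simp only [pullback, mfderiv_snd]
  rfl

variable [I.Boundaryless] [IsManifold I ∞ M] [J.Boundaryless] [IsManifold J ∞ N]

theorem mfderiv_chart_symm_prod {p : M × N} {y : E × F}
    (hy : y ∈ (extChartAt (I.prod J) p).target) (u : E × F) :
    (mfderiv 𝓘(ℝ, E × F) (I.prod J) (extChartAt (I.prod J) p).symm y u : E × F) =
      (mfderiv 𝓘(ℝ, E) I (extChartAt I p.1).symm y.1 u.1,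
        mfderiv 𝓘(ℝ, F) J (extChartAt J p.2).symm y.2 u.2) := by
  have hd := mdifferentiableAt_chart_symm (I := I.prod J) hy
  rw [extChartAt_prod, PartialEquiv.prod_target] at hy
  refine Prod.ext ?_ ?_
  · have h1 := mfderiv_comp_apply y (mdifferentiableAt_fst (I := I) (I' := J)) hd u
    have h2 := mfderiv_comp_apply y (mdifferentiableAt_chart_symm hy.1)
      (differentiableAt_fst (𝕜 := ℝ)).mdifferentiableAt u
    have he : Prod.fst ∘ (extChartAt (I.prod J) p).symm =
        (extChartAt I p.1).symm ∘ (Prod.fst : E × F → E) := by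
      funext z
      rw [Function.comp_apply, extChartAt_prod]
      rfl
    rw [he, h2, mfderiv_fst, mfderiv_eq_fderiv, fderiv_fst] at h1
    exact h1.symm
  · have h1 := mfderiv_comp_apply y (mdifferentiableAt_snd (I := I) (I' := J)) hd u
    have h2 := mfderiv_comp_apply y (mdifferentiableAt_chart_symm hy.2)
      (differentiableAt_snd (𝕜 := ℝ)).mdifferentiableAt u
    have he : Prod.snd ∘ (extChartAt (I.prod J) p).symm =
        (extChartAt J p.2).symm ∘ (Prod.snd : E × F → F) := by
      funext z
      rw [Function.comp_apply, extChartAt_prod]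
      rfl
    rw [he, h2, mfderiv_snd, mfderiv_eq_fderiv, fderiv_snd] at h1
    exact h1.symm

end ProductChart

section Product

variable {S : Type*} [TopologicalSpace S] [ChartedSpace E2 S]

theorem sphereTensor_apply (p : S2 × S) (u v : E2 × E2) :
    sphereTensor p u v = roundMetric p.1 u.1 v.1 :=
  pullback_fst_apply roundMetric p u v

theorem surfaceTensor_apply (h : FormField (𝓡 2) S) (p : S2 × S) (u v : E2 × E2) :
    surfaceTensor h p u v = h p.2 u.2 v.2 :=
  pullback_snd_apply h p u v

theorem productMetric_apply (h : FormField (𝓡 2) S) (p : S2 × S) (u v : E2 × E2) :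
    productMetric h p u v = roundMetric p.1 u.1 v.1 + h p.2 u.2 v.2 :=
  congrArg₂ (· + ·) (sphereTensor_apply p u v) (surfaceTensor_apply h p u v)

variable [IsManifold (𝓡 2) ∞ S]

theorem chartForm_productMetric (h : FormField (𝓡 2) S) {p : S2 × S} {y : E2 × E2}
    (hy : y ∈ (extChartAt ((𝓡 2).prod (𝓡 2)) p).target) (u v : E2 × E2) :
    chartForm ((𝓡 2).prod (𝓡 2)) (productMetric h) p y u v =
      chartForm (𝓡 2) roundMetric p.1 y.1 u.1 v.1 + chartForm (𝓡 2) h p.2 y.2 u.2 v.2 := by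
  rw [chartForm_apply]
  have e (w : E2 × E2) := mfderiv_chart_symm_prod hy w
  have hx : (extChartAt ((𝓡 2).prod (𝓡 2)) p).symm y =
      ((extChartAt (𝓡 2) p.1).symm y.1, (extChartAt (𝓡 2) p.2).symm y.2) := by
    rw [extChartAt_prod]
    rfl
  refine (productMetric_apply h _ _ _).trans (congrArg₂ (· + ·) ?_ ?_)
  · exact formField_congr _ (congrArg Prod.fst hx) (congrArg Prod.fst (e u))
      (congrArg Prod.fst (e v))
  · exact formField_congr _ (congrArg Prod.snd hx) (congrArg Prod.snd (e u))
      (congrArg Prod.snd (e v))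

variable (h : Bundle.ContMDiffRiemannianMetric (𝓡 2) ∞ E2 (fun x : S => TangentSpace (𝓡 2) x))

theorem roundMetric_pos (a : S2) (u : E2) (hu : u ≠ 0) : 0 < roundMetric a u u := by
  have := mfderiv_coe_S2_injective a
  refine (real_inner_self_pos (F := E3)).2 fun h0 => hu (this ?_)
  exact h0.trans (ContinuousLinearMap.map_zero _).symm

theorem roundMetric_symm (a : S2) (u v : E2) : roundMetric a u v = roundMetric a v u :=
  real_inner_comm (F := E3) _ _

theorem productMetric_symm (p : S2 × S) (u v : E2 × E2) :
    productMetric h.inner p u v = productMetric h.inner p v u := by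
  rw [productMetric_apply, productMetric_apply, roundMetric_symm]
  exact congrArg _ (h.symm _ _ _)

theorem productMetric_pos (p : S2 × S) (u : E2 × E2) (hu : u ≠ 0) :
    0 < productMetric h.inner p u u := by
  rw [productMetric_apply]
  have h1 (a : S2) (u : E2) : 0 ≤ roundMetric a u u := real_inner_self_nonneg (F := E3)
  have h2 (b : S) (u : E2) : 0 ≤ h.inner b u u := by
    rcases eq_or_ne u 0 with rfl | hu
    · exact (ContinuousLinearMap.map_zero _).ge
    · exact (h.pos b u hu).le
  by_cases hu1 : u.1 = 0
  · have hu2 : u.2 ≠ 0 := fun h2 => hu (Prod.ext hu1 h2)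
    exact add_pos_of_nonneg_of_pos (h1 _ _) (h.pos _ _ hu2)
  · exact add_pos_of_pos_of_nonneg (roundMetric_pos _ _ hu1) (h2 _ _)

theorem isMetricAt_chartForm_productMetric {p : S2 × S} {y : E2 × E2}
    (hy : y ∈ (extChartAt ((𝓡 2).prod (𝓡 2)) p).target) :
    IsMetricAt (chartForm ((𝓡 2).prod (𝓡 2)) (productMetric h.inner) p) y := by
  have hev := (isOpen_extChartAt_target (I := (𝓡 2).prod (𝓡 2)) p).mem_nhds hy
  have he : chartForm ((𝓡 2).prod (𝓡 2)) (productMetric h.inner) p =ᶠ[𝓝 y]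
      fun z => pullbackForm Prod.fst (chartForm (𝓡 2) roundMetric p.1) z +
        pullbackForm Prod.snd (chartForm (𝓡 2) h.inner p.2) z := by
    filter_upwards [hev] with z hz
    refine ContinuousLinearMap.ext fun u => ContinuousLinearMap.ext fun v => ?_
    rw [chartForm_productMetric h.inner hz, add_apply,
      add_apply, pullbackForm_apply, pullbackForm_apply, fderiv_fst, fderiv_snd]
    rfl
  have hy' := hy
  rw [extChartAt_prod, PartialEquiv.prod_target] at hy'
  refine isMetricAt_of_pos (((contDiffAt_pullbackForm contDiffAt_fst
    (isMetricAt_chartForm_roundMetric hy'.1).smooth).add (contDiffAt_pullbackForm contDiffAt_snd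
    (isMetricAt_chartForm_surface h hy'.2).smooth)).congr_of_eventuallyEq he)
    (fun u v => ?_) fun v hv => ?_
  · rw [chartForm_apply, chartForm_apply]
    exact productMetric_symm h _ _ _
  · rw [chartForm_apply]
    refine productMetric_pos h _ _ fun h0 => hv (mfderiv_chart_symm_injective hy ?_)
    exact h0.trans (ContinuousLinearMap.map_zero _).symm

variable {h}

theorem coordCurvature_productMetric (hh : HasConstCurvOn (𝓡 2) h.inner (-1) Set.univ)
    (p : S2 × S) (u v w : E2 × E2) :
    coordCurvature (chartForm ((𝓡 2).prod (𝓡 2)) (productMetric h.inner) p)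
        (extChartAt ((𝓡 2).prod (𝓡 2)) p p) u v w =
      (roundMetric p.1 v.1 w.1 • u.1 - roundMetric p.1 u.1 w.1 • v.1,
        (-1 : ℝ) • (h.inner p.2 v.2 w.2 • u.2 - h.inner p.2 u.2 w.2 • v.2)) := by
  have hev := (isOpen_extChartAt_target (I := (𝓡 2).prod (𝓡 2)) p).eventually_mem
    (mem_extChartAt_target p)
  have hx : extChartAt ((𝓡 2).prod (𝓡 2)) p p =
      (extChartAt (𝓡 2) p.1 p.1, extChartAt (𝓡 2) p.2 p.2) := by
    simp
  have hev1 := (isOpen_extChartAt_target (I := 𝓡 2) p.1).eventually_mem (mem_extChartAt_target p.1)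
  have hev2 := (isOpen_extChartAt_target (I := 𝓡 2) p.2).eventually_mem (mem_extChartAt_target p.2)
  rw [coordCurvature_prod (G₁ := chartForm (𝓡 2) roundMetric p.1)
    (G₂ := chartForm (𝓡 2) h.inner p.2)
    (by rw [hx]; exact hev1.mono fun y hy => isMetricAt_chartForm_roundMetric hy)
    (by rw [hx]; exact hev2.mono fun y hy => isMetricAt_chartForm_surface h hy)
    (hev.mono fun y hy => isMetricAt_chartForm_productMetric h hy)
    (hev.mono fun y hy => chartForm_productMetric h.inner hy), hx]
  simp only [coordCurvature_roundMetric, coordCurvature_surface_self hh, chartForm_self]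

theorem curvature_productMetric (hh : HasConstCurvOn (𝓡 2) h.inner (-1) Set.univ)
    (p : S2 × S) (X Y Z T : E2 × E2) :
    curvature ((𝓡 2).prod (𝓡 2)) (productMetric h.inner) p X Y Z T =
      kulkarniNomizu (V := E2 × E2) (fun v w => productMetric h.inner p v w)
        (fun v w => (sphereTensor p v w - surfaceTensor h.inner p v w) / 2) X Y Z T := by
  have hc : curvature ((𝓡 2).prod (𝓡 2)) (productMetric h.inner) p X Y Z T =
      productMetric h.inner p (coordCurvature (chartForm ((𝓡 2).prod (𝓡 2))
        (productMetric h.inner) p) (extChartAt ((𝓡 2).prod (𝓡 2)) p p) X Y T : E2 × E2) Z := rfl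
  rw [hc, coordCurvature_productMetric hh]
  simp only [kulkarniNomizu, Matrix.det_fin_two_of, productMetric_apply, sphereTensor_apply,
    surfaceTensor_apply]
  have l1 (a b : ℝ) (u v w : E2) : roundMetric p.1 (a • u - b • v : E2) w =
      a * roundMetric p.1 u w - b * roundMetric p.1 v w := by
    erw [map_sub, map_smul, map_smul]
    rfl
  have l2 (a b : ℝ) (u v w : E2) : h.inner p.2 ((-1 : ℝ) • (a • u - b • v) : E2) w =
      - (a * h.inner p.2 u w - b * h.inner p.2 v w) := by
    erw [map_smul, map_sub, map_smul, map_smul, neg_one_smul]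
    rfl
  rw [l1, l2]
  ring

end Product

section Coordinates

open scoped InnerProductSpace

theorem coordCurvature_const {F : Type*} [NormedAddCommGroup F] [NormedSpace ℝ F]
    (B : F →L[ℝ] F →L[ℝ] ℝ) (x u v w : F) :
    coordCurvature (fun _ => B) x u v w = 0 := by
  have h (y u v : F) : christoffel (fun _ => B) y u v = 0 := by
    have : christoffelFirst (fun _ => B) y u v = 0 := by
      simp [christoffelFirst]
    rw [christoffel, this, map_zero]
  simp [coordCurvature, h]

/-- The Euclidean scalar product of `ℝ × ℝ³`. -/
def prodInner : (ℝ × E3) →L[ℝ] (ℝ × E3) →L[ℝ] ℝ :=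
  (innerSL ℝ : ℝ →L[ℝ] ℝ →L[ℝ] ℝ).bilinearComp (.fst ℝ ℝ E3) (.fst ℝ ℝ E3) +
    (innerSL ℝ : E3 →L[ℝ] E3 →L[ℝ] ℝ).bilinearComp (.snd ℝ ℝ E3) (.snd ℝ ℝ E3)

theorem prodInner_apply (u v : ℝ × E3) : prodInner u v = u.1 * v.1 + ⟪u.2, v.2⟫_ℝ := by
  change ⟪u.1, v.1⟫_ℝ + ⟪u.2, v.2⟫_ℝ = _
  rw [real_inner_eq_re_inner, RCLike.inner_apply]
  simp [mul_comm]

theorem isMetricAt_prodInner (x : ℝ × E3) : IsMetricAt (fun _ => prodInner) x := by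
  refine isMetricAt_of_pos contDiffAt_const (fun u v => ?_) fun v hv => ?_
  · rw [prodInner_apply, prodInner_apply, mul_comm, real_inner_comm]
  · rw [prodInner_apply]
    by_cases h1 : v.1 = 0
    · have h2 : v.2 ≠ 0 := fun h2 => hv (Prod.ext h1 h2)
      have := real_inner_self_pos.2 h2
      have := mul_self_nonneg v.1
      linarith
    · have := mul_self_pos.2 h1
      have := real_inner_self_nonneg (F := E3) (x := v.2)
      linarith

/-- `Y² g_{S²} + dX² + dY²` is flat: it is induced by `(X, Y σ)`, polar coordinates on
`ℝ × ℝ³`. -/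
theorem coordCurvature_of_polar {σ : E2 → E3} {X Y : E2 → ℝ}
    {G : E2 × E2 → E2 × E2 →L[ℝ] E2 × E2 →L[ℝ] ℝ} {x : E2 × E2}
    (hσ : ∀ᶠ y in 𝓝 x.1, ContDiffAt ℝ ∞ σ y) (hn : ∀ y, ‖σ y‖ = 1)
    (hX : ∀ᶠ y in 𝓝 x.2, ContDiffAt ℝ ∞ X y) (hY : ∀ᶠ y in 𝓝 x.2, ContDiffAt ℝ ∞ Y y)
    (hG : ∀ᶠ y in 𝓝 x, ∀ u v, G y u v =
      Y y.2 ^ 2 * ⟪fderiv ℝ σ y.1 u.1, fderiv ℝ σ y.1 v.1⟫_ℝ +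
        (fderiv ℝ X y.2 u.2 * fderiv ℝ X y.2 v.2 + fderiv ℝ Y y.2 u.2 * fderiv ℝ Y y.2 v.2))
    (hpos : ∀ᶠ y in 𝓝 x, ∀ v, v ≠ 0 → 0 < G y v v) (u v w : E2 × E2) :
    coordCurvature G x u v w = 0 := by
  set Φ : E2 × E2 → ℝ × E3 := fun y => (X y.2, Y y.2 • σ y.1)
  replace hσ := continuousAt_fst.eventually hσ
  replace hX := continuousAt_snd.eventually hX
  replace hY := continuousAt_snd.eventually hY
  have hΦ : ∀ᶠ y in 𝓝 x, ContDiffAt ℝ ∞ Φ y := by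
    filter_upwards [hσ, hX, hY] with y h1 h2 h3
    exact (h2.comp y contDiffAt_snd).prodMk
      ((h3.comp y contDiffAt_snd).smul (h1.comp y contDiffAt_fst))
  have hG' : ∀ᶠ y in 𝓝 x, ∀ u v, G y u v = prodInner (fderiv ℝ Φ y u) (fderiv ℝ Φ y v) := by
    filter_upwards [hσ, hX, hY, hG] with y h1 h2 h3 h4 u v
    have d1 := (h1.differentiableAt (by simp)).hasFDerivAt
    have d2 := (h2.differentiableAt (by simp)).hasFDerivAt
    have d3 := (h3.differentiableAt (by simp)).hasFDerivAt
    have hd : HasFDerivAt Φ _ y := (d2.comp y hasFDerivAt_snd).prodMk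
      ((d3.comp y hasFDerivAt_snd).smul (d1.comp y hasFDerivAt_fst))
    have ho (u : E2) : ⟪σ y.1, fderiv ℝ σ y.1 u⟫_ℝ = 0 :=
      inner_fderiv_of_norm_eq_one d1.differentiableAt (.of_forall hn) u
    have ho' (u : E2) : ⟪fderiv ℝ σ y.1 u, σ y.1⟫_ℝ = 0 := by rw [real_inner_comm, ho]
    rw [h4, hd.fderiv, prodInner_apply]
    simp [inner_add_left, inner_add_right, inner_smul_left, inner_smul_right, ho, ho', hn]
    ring
  have hm : ∀ᶠ y in 𝓝 x, IsMetricAt G y := by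
    filter_upwards [hΦ, hG'.eventually_nhds, hG, hpos] with y h1 h2 h3 h4
    refine isMetricAt_of_pos ((contDiffAt_pullbackForm h1
      (contDiffAt_const (c := prodInner))).congr_of_eventuallyEq (eventuallyEq_pullbackForm h2))
      (fun u v => ?_) h4
    rw [h3, h3, real_inner_comm]
    ring
  have hinj : ∀ᶠ y in 𝓝 x, Function.Injective (fderiv ℝ Φ y) := by
    filter_upwards [hG', hm] with y h1 h2 using
      fderiv_injective_of_pullback (G := fun _ => prodInner) h1 h2
  have hsurj : ∀ᶠ y in 𝓝 x, Function.Surjective (fderiv ℝ Φ y) := by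
    filter_upwards [hinj] with y hy
    refine (LinearMap.injective_iff_surjective_of_finrank_eq_finrank
      (f := (fderiv ℝ Φ y : E2 × E2 →ₗ[ℝ] ℝ × E3)) ?_).1 hy
    simp
  have key := fderiv_coordCurvature_of_pullback (G := fun _ => prodInner) hΦ
    (.of_forall isMetricAt_prodInner) hG' hm hsurj u v w
  rw [coordCurvature_const] at key
  exact hinj.self_of_nhds (key.trans (map_zero _).symm)

end Coordinates

section Product

variable {S : Type*} [TopologicalSpace S] [ChartedSpace E2 S] [IsManifold (𝓡 2) ∞ S]
  {h : Bundle.ContMDiffRiemannianMetric (𝓡 2) ∞ E2 (fun x : S => TangentSpace (𝓡 2) x)}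

theorem isLocallyConformallyFlat_productMetric
    (hh : HasConstCurvOn (𝓡 2) h.inner (-1) Set.univ) :
    IsLocallyConformallyFlat ((𝓡 2).prod (𝓡 2)) (productMetric h.inner) := by
  rintro ⟨a, b⟩
  have hb := (isOpen_extChartAt_target (I := 𝓡 2) b).eventually_mem (mem_extChartAt_target b)
  obtain ⟨s, hs, hbs, X, Y, hX, hY, hXY⟩ := exists_halfPlane_coordinates
    (G := chartForm (𝓡 2) h.inner b) (x := extChartAt (𝓡 2) b b) (by simp)
    (hb.mono fun y hy => isMetricAt_chartForm_surface h hy)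
    (fun v hv => by rw [chartForm_self]; exact h.pos b v hv)
    (hb.mono fun y hy => coordCurvature_surface hh hy)
  have hV : IsOpen ((extChartAt (𝓡 2) b).source ∩ extChartAt (𝓡 2) b ⁻¹' s) :=
    (continuousOn_extChartAt b).isOpen_inter_preimage (isOpen_extChartAt_source b) hs
  refine ⟨Prod.snd ⁻¹' ((extChartAt (𝓡 2) b).source ∩ extChartAt (𝓡 2) b ⁻¹' s),
    hV.preimage continuous_snd, ⟨mem_extChartAt_source b, hbs⟩,
    fun q => Y (extChartAt (𝓡 2) b q.2) ^ 2, ?_, fun q hq => pow_pos (hXY _ hq.2).1 2, ?_⟩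
  · refine ContMDiffOn.comp (I' := 𝓘(ℝ, E2)) (t := s) (hY.pow 2).contMDiffOn
      ((contMDiffOn_extChartAt (I := 𝓡 2)).comp contMDiff_snd.contMDiffOn fun q hq => ?_)
      fun q hq => hq.2
    simpa using hq.1
  intro q hq u v _
  set τ := transition (𝓡 2) b q.2
  have hev2 : ∀ᶠ y in 𝓝 (extChartAt (𝓡 2) q.2 q.2), (y ∈ (extChartAt (𝓡 2) q.2).target ∧
      (extChartAt (𝓡 2) q.2).symm y ∈ (extChartAt (𝓡 2) b).source) ∧ τ y ∈ s := by
    have hev := eventually_mem_transition (I := 𝓡 2) hq.1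
    refine hev.and ?_
    have hc : ContinuousAt τ (extChartAt (𝓡 2) q.2 q.2) :=
      (contDiffAt_transition hev.self_of_nhds.1 hev.self_of_nhds.2).continuousAt
    refine hc.eventually (hs.eventually_mem ?_)
    rw [show τ _ = _ from transition_self]
    exact hq.2
  have hev1 := (isOpen_extChartAt_target (I := 𝓡 2) q.1).eventually_mem (mem_extChartAt_target q.1)
  have hev := (isOpen_extChartAt_target (I := (𝓡 2).prod (𝓡 2)) q).eventually_mem
    (mem_extChartAt_target q)
  have hx : extChartAt ((𝓡 2).prod (𝓡 2)) q q =
      (extChartAt (𝓡 2) q.1 q.1, extChartAt (𝓡 2) q.2 q.2) := by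
    simp
  have hform {y : E2 × E2} (u v : E2 × E2) : chartForm ((𝓡 2).prod (𝓡 2))
      (fun q => Y (extChartAt (𝓡 2) b q.2) ^ 2 • productMetric h.inner q) q y u v =
      Y (τ y.2) ^ 2 * chartForm ((𝓡 2).prod (𝓡 2)) (productMetric h.inner) q y u v := by
    have : τ y.2 = extChartAt (𝓡 2) b ((extChartAt ((𝓡 2).prod (𝓡 2)) q).symm y).2 := by
      rw [extChartAt_prod]
      rfl
    rw [this]
    rfl
  have hev2' := (continuousAt_snd (p := extChartAt ((𝓡 2).prod (𝓡 2)) q q)).eventually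
    (p := fun y => (y ∈ (extChartAt (𝓡 2) q.2).target ∧
      (extChartAt (𝓡 2) q.2).symm y ∈ (extChartAt (𝓡 2) b).source) ∧ τ y ∈ s) (by rwa [hx])
  have hτ {y : E2} (hy : (y ∈ (extChartAt (𝓡 2) q.2).target ∧
      (extChartAt (𝓡 2) q.2).symm y ∈ (extChartAt (𝓡 2) b).source) ∧ τ y ∈ s) :=
    contDiffAt_transition (I := 𝓡 2) hy.1.1 hy.1.2
  have key := coordCurvature_of_polar (σ := sphereEmb q.1) (X := X ∘ τ) (Y := Y ∘ τ)
    (G := chartForm ((𝓡 2).prod (𝓡 2))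
      (fun q => Y (extChartAt (𝓡 2) b q.2) ^ 2 • productMetric h.inner q) q)
    (x := extChartAt ((𝓡 2).prod (𝓡 2)) q q)
    (by rw [hx]; exact hev1.mono fun y hy => contDiffAt_sphereEmb hy)
    (norm_sphereEmb q.1)
    (by
      rw [hx]
      exact hev2.mono fun y hy => (hX.contDiffAt (hs.mem_nhds hy.2)).comp y (hτ hy))
    (by
      rw [hx]
      exact hev2.mono fun y hy => (hY.contDiffAt (hs.mem_nhds hy.2)).comp y (hτ hy))
    (by
      filter_upwards [hev2', hev] with y h1 h2 u v
      have h3 := h2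
      rw [extChartAt_prod, PartialEquiv.prod_target] at h3
      have e1 := ((hX.contDiffAt (hs.mem_nhds h1.2)).differentiableAt (by simp)).hasFDerivAt.comp
        y.2 ((hτ h1).differentiableAt (by simp)).hasFDerivAt
      have e2 := ((hY.contDiffAt (hs.mem_nhds h1.2)).differentiableAt (by simp)).hasFDerivAt.comp
        y.2 ((hτ h1).differentiableAt (by simp)).hasFDerivAt
      rw [hform, chartForm_productMetric _ h2, chartForm_roundMetric h3.1,
        chartForm_transition h.inner h1.1.1 h1.1.2, e1.fderiv, e2.fderiv, mul_add]
      exact congrArg _ ((hXY _ h1.2).2 _ _).symm)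
    (by
      filter_upwards [hev2', hev] with y h1 h2 v hv
      rw [hform]
      refine mul_pos (pow_pos (hXY _ h1.2).1 2) ?_
      rw [chartForm_apply]
      refine productMetric_pos h _ _ fun h0 => hv (mfderiv_chart_symm_injective h2 ?_)
      exact h0.trans (ContinuousLinearMap.map_zero _).symm)
  have hc : curvature ((𝓡 2).prod (𝓡 2))
      (fun q => Y (extChartAt (𝓡 2) b q.2) ^ 2 • productMetric h.inner q) q u v u v = 0 := by
    have h0 : (Y (extChartAt (𝓡 2) b q.2) ^ 2 • productMetric h.inner q) (0 : E2 × E2) u = 0 :=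
      DFunLike.congr_fun (ContinuousLinearMap.map_zero _) _
    exact (congrArg (fun z : E2 × E2 =>
      (Y (extChartAt (𝓡 2) b q.2) ^ 2 • productMetric h.inner q) z u) (key u v v)).trans h0
  rw [sectional, hc, zero_div]

end Product

section Algebra

variable {V : Type*} [AddCommGroup V] [Module ℝ V] [Module.Finite ℝ V]
  {g : V →ₗ[ℝ] V →ₗ[ℝ] ℝ}

theorem metricTrace_eq_trace (hs : ∀ u v, g u v = g v u) (hn : ∀ u, (∀ v, g u v = 0) → u = 0)
    (L : V →ₗ[ℝ] V) :
    metricTrace (fun u v => g u v) (fun u v => g (L u) v) = LinearMap.trace ℝ V L := by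
  set b := Module.finBasis ℝ V
  set A : Matrix _ _ ℝ := Matrix.of fun k l => g (b k) (b l)
  have hAt : A.transpose = A := Matrix.ext fun i j => hs _ _
  have hdet : IsUnit A.det := by
    have hnd : g.Nondegenerate := by
      refine ⟨fun u hu => hn u hu, fun u hu => hn u fun v => by rw [hs, hu]⟩
    have := (LinearMap.BilinForm.nondegenerate_iff_det_ne_zero (B := g) b).1 hnd
    rw [isUnit_iff_ne_zero]
    convert this
    ext i j
    simp [A]
  have hB (i j) : g (L (b i)) (b j) = ((LinearMap.toMatrix b b L).transpose * A) i j := by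
    rw [Matrix.mul_apply]
    conv_lhs => rw [← b.sum_repr (L (b i))]
    simp only [map_sum, map_smul, LinearMap.sum_apply, LinearMap.smul_apply, smul_eq_mul,
      Matrix.transpose_apply, LinearMap.toMatrix_apply, A, Matrix.of_apply]
  rw [LinearMap.trace_eq_matrix_trace ℝ b]
  calc _ = ∑ i, ∑ j, A⁻¹ i j * ((LinearMap.toMatrix b b L).transpose * A) i j :=
        Finset.sum_congr rfl fun i _ => Finset.sum_congr rfl fun j _ => congrArg (A⁻¹ i j * ·) (hB i j)
    _ = ∑ i, (((LinearMap.toMatrix b b L).transpose * A) * (A⁻¹).transpose) i i := by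
        refine Finset.sum_congr rfl fun i _ => ?_
        rw [Matrix.mul_apply]
        exact Finset.sum_congr rfl fun j _ => by rw [mul_comm, Matrix.transpose_apply]
    _ = _ := by
        rw [Matrix.transpose_nonsing_inv, hAt, Matrix.mul_nonsing_inv_cancel_right _ _ hdet,
          ← Matrix.trace_transpose]
        rfl

theorem ricci_kulkarniNomizu (hs : ∀ u v, g u v = g v u) (hn : ∀ u, (∀ v, g u v = 0) → u = 0)
    (Q : V →ₗ[ℝ] V) (Y T : V) :
    ricci (fun u v => g u v) (kulkarniNomizu (fun u v => g u v) fun u v => g (Q u) v) Y T =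
      (Module.finrank ℝ V - 2) * g (Q Y) T + LinearMap.trace ℝ V Q * g Y T := by
  let L : V →ₗ[ℝ] V := g (Q Y) T • LinearMap.id - ((g.flip T) ∘ₗ Q).smulRight Y + g Y T • Q -
    (g.flip T).smulRight (Q Y)
  have he : (fun X Z => kulkarniNomizu (fun u v => g u v) (fun u v => g (Q u) v) X Y Z T) =
      fun X Z => g (L X) Z := by
    funext X Z
    simp [kulkarniNomizu, Matrix.det_fin_two_of, L]
    ring
  rw [ricci, he, metricTrace_eq_trace hs hn]
  simp [LinearMap.trace_smulRight, L]
  ring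

theorem scalar_kulkarniNomizu (hs : ∀ u v, g u v = g v u) (hn : ∀ u, (∀ v, g u v = 0) → u = 0)
    (Q : V →ₗ[ℝ] V) :
    scalar (fun u v => g u v) (kulkarniNomizu (fun u v => g u v) fun u v => g (Q u) v) =
      2 * (Module.finrank ℝ V - 1) * LinearMap.trace ℝ V Q := by
  let L : V →ₗ[ℝ] V := ((Module.finrank ℝ V : ℝ) - 2) • Q + LinearMap.trace ℝ V Q • LinearMap.id
  have he : ricci (fun u v => g u v)
      (kulkarniNomizu (fun u v => g u v) fun u v => g (Q u) v) = fun Y T => g (L Y) T := by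
    funext Y T
    rw [ricci_kulkarniNomizu hs hn]
    simp [L]
  rw [scalar, he, metricTrace_eq_trace hs hn]
  simp [L]
  ring

/-- A curvature tensor of the form `g ∧ A` has no Weyl part. -/
theorem weylPart_kulkarniNomizu (hs : ∀ u v, g u v = g v u)
    (hn : ∀ u, (∀ v, g u v = 0) → u = 0) (hV : 2 < Module.finrank ℝ V) (Q : V →ₗ[ℝ] V)
    (X Y Z T : V) :
    weylPart (fun u v => g u v) (kulkarniNomizu (fun u v => g u v) fun u v => g (Q u) v)
      X Y Z T = 0 := by
  have h2 : (2 : ℝ) < Module.finrank ℝ V := by exact_mod_cast hV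
  have h3 : (Module.finrank ℝ V : ℝ) - 2 ≠ 0 := by linarith
  have h4 : (Module.finrank ℝ V : ℝ) - 1 ≠ 0 := by linarith
  have h5 : (Module.finrank ℝ V : ℝ) ≠ 0 := by linarith
  simp only [weylPart, scalar_kulkarniNomizu hs hn, ricci_kulkarniNomizu hs hn, kulkarniNomizu,
    Matrix.det_fin_two_of]
  field_simp
  ring

theorem antiSelfDualPartVanishes_zero (g : V → V → ℝ) (o : Orientation ℝ V (Fin 4)) :
    AntiSelfDualPartVanishes g o fun _ _ _ _ => 0 := by
  intro β γ _ _
  simp [actTwo, innerTwo, metricTrace]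

end Algebra

section Product

variable {S : Type*} [TopologicalSpace S] [ChartedSpace E2 S] [IsManifold (𝓡 2) ∞ S]
  {h : Bundle.ContMDiffRiemannianMetric (𝓡 2) ∞ E2 (fun x : S => TangentSpace (𝓡 2) x)}

theorem weyl_productMetric (hh : HasConstCurvOn (𝓡 2) h.inner (-1) Set.univ) (p : S2 × S)
    (X Y Z T : E2 × E2) :
    weyl ((𝓡 2).prod (𝓡 2)) (productMetric h.inner) p X Y Z T = 0 := by
  let g : E2 × E2 →ₗ[ℝ] E2 × E2 →ₗ[ℝ] ℝ := ContinuousLinearMap.toLinearMap₁₂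
    (show E2 × E2 →L[ℝ] E2 × E2 →L[ℝ] ℝ from productMetric h.inner p)
  have hg (u v : E2 × E2) : g u v = productMetric h.inner p u v := rfl
  let Q : E2 × E2 →ₗ[ℝ] E2 × E2 := LinearMap.prodMap ((1 / 2 : ℝ) • LinearMap.id)
    (-(1 / 2 : ℝ) • LinearMap.id)
  have hQ (u v : E2 × E2) :
      g (Q u) v = (sphereTensor p u v - surfaceTensor h.inner p u v) / 2 := by
    have l1 (a : ℝ) (u v : E2) : roundMetric p.1 (a • u : E2) v = a * roundMetric p.1 u v :=
      DFunLike.congr_fun (ContinuousLinearMap.map_smul (roundMetric p.1 : E2 →L[ℝ] E2 →L[ℝ] ℝ) a u)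
        v
    have l2 (a : ℝ) (u v : E2) : h.inner p.2 (a • u : E2) v = a * h.inner p.2 u v :=
      DFunLike.congr_fun (ContinuousLinearMap.map_smul (h.inner p.2 : E2 →L[ℝ] E2 →L[ℝ] ℝ) a u) v
    rw [hg, productMetric_apply, sphereTensor_apply, surfaceTensor_apply]
    have := l1 (1 / 2) u.1 v.1
    have := l2 (-(1 / 2)) u.2 v.2
    simp only [Q, LinearMap.prodMap_apply, LinearMap.smul_apply, LinearMap.id_apply, *]
    ring
  have hc : curvature ((𝓡 2).prod (𝓡 2)) (productMetric h.inner) p =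
      kulkarniNomizu (V := E2 × E2) (fun u v => g u v) fun u v => g (Q u) v := by
    funext X Y Z T
    simp only [hQ]
    exact curvature_productMetric hh p X Y Z T
  rw [weyl, hc]
  refine weylPart_kulkarniNomizu (V := E2 × E2) (g := g) (fun u v => productMetric_symm h p u v)
    (fun u hu => ?_) (by simp) Q X Y Z T
  by_contra h0
  exact (productMetric_pos h p u h0).ne' (hu u)

theorem isSelfDual_productMetric (hh : HasConstCurvOn (𝓡 2) h.inner (-1) Set.univ)
    (o : ManifoldOrientation ((𝓡 2).prod (𝓡 2)) (S2 × S) 4) :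
    IsSelfDual (productMetric h.inner) o := by
  intro p
  have hw : weyl ((𝓡 2).prod (𝓡 2)) (productMetric h.inner) p = fun _ _ _ _ => 0 := by
    funext X Y Z T
    exact weyl_productMetric hh p X Y Z T
  rw [hw]
  exact antiSelfDualPartVanishes_zero _ _

end Product

section LinearAlgebra

variable {V W V' W' : Type*} [AddCommGroup V] [Module ℝ V] [AddCommGroup W] [Module ℝ W]
  [AddCommGroup V'] [Module ℝ V'] [AddCommGroup W'] [Module ℝ W']

/-- The basis of `V × W` consisting of a basis of `V` followed by a basis of `W`. -/
def prodBasis (b : Module.Basis (Fin 2) ℝ V) (c : Module.Basis (Fin 2) ℝ W) :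
    Module.Basis (Fin 4) ℝ (V × W) :=
  (b.prod c).reindex finSumFinEquiv

theorem prodBasis_map (b : Module.Basis (Fin 2) ℝ V) (c : Module.Basis (Fin 2) ℝ W)
    (A : V ≃ₗ[ℝ] V') (B : W ≃ₗ[ℝ] W') :
    (prodBasis b c).map (A.prodCongr B) = prodBasis (b.map A) (c.map B) := by
  refine Module.Basis.eq_of_apply_eq fun i => ?_
  obtain ⟨i, rfl⟩ := (finSumFinEquiv (m := 2) (n := 2)).surjective i
  rcases i with i | i <;> simp [prodBasis]

theorem orientation_prodBasis {b b' : Module.Basis (Fin 2) ℝ V} {c c' : Module.Basis (Fin 2) ℝ W}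
    (hb : b.orientation = b'.orientation) (hc : c.orientation = c'.orientation) :
    (prodBasis b c).orientation = (prodBasis b' c').orientation := by
  rw [Module.Basis.orientation_eq_iff_det_pos] at hb hc
  rw [prodBasis, prodBasis, Module.Basis.orientation_reindex, Module.Basis.orientation_reindex]
  congr 1
  rw [Module.Basis.orientation_eq_iff_det_pos, Module.Basis.det_apply]
  have : (b.prod c).toMatrix (b'.prod c') =
      Matrix.fromBlocks (b.toMatrix b') 0 0 (c.toMatrix c') := by
    ext i j
    rcases i with i | i <;> rcases j with j | j <;> simp [Module.Basis.toMatrix_apply]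
  rw [this, Matrix.det_fromBlocks_zero₂₁, ← Module.Basis.det_apply, ← Module.Basis.det_apply]
  exact mul_pos hb hc

/-- The orientation of `V × W` induced by orientations of `V` and `W`. -/
def prodOrientation [FiniteDimensional ℝ V] [FiniteDimensional ℝ W]
    (hV : Module.finrank ℝ V = 2) (hW : Module.finrank ℝ W = 2)
    (o : Orientation ℝ V (Fin 2)) (o' : Orientation ℝ W (Fin 2)) :
    Orientation ℝ (V × W) (Fin 4) :=
  (prodBasis (o.someBasis (by simp [hV])) (o'.someBasis (by simp [hW]))).orientation

theorem orientation_map_eq_iff [FiniteDimensional ℝ V] [FiniteDimensional ℝ W]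
    [FiniteDimensional ℝ V'] [FiniteDimensional ℝ W']
    {hV : Module.finrank ℝ V = 2} {hW : Module.finrank ℝ W = 2}
    {hV' : Module.finrank ℝ V' = 2} {hW' : Module.finrank ℝ W' = 2}
    {o₁ : Orientation ℝ V (Fin 2)} {o₂ : Orientation ℝ W (Fin 2)}
    {o₁' : Orientation ℝ V' (Fin 2)} {o₂' : Orientation ℝ W' (Fin 2)}
    (A : V ≃ₗ[ℝ] V') (B : W ≃ₗ[ℝ] W')
    (hA : ∀ b : Module.Basis (Fin 2) ℝ V, b.orientation = o₁ → (b.map A).orientation = o₁')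
    (hB : ∀ b : Module.Basis (Fin 2) ℝ W, b.orientation = o₂ → (b.map B).orientation = o₂')
    (b : Module.Basis (Fin 4) ℝ (V × W)) :
    b.orientation = prodOrientation hV hW o₁ o₂ ↔
      (b.map (A.prodCongr B)).orientation = prodOrientation hV' hW' o₁' o₂' := by
  have h : prodOrientation hV' hW' o₁' o₂' =
      Orientation.map (Fin 4) (A.prodCongr B) (prodOrientation hV hW o₁ o₂) := by
    rw [prodOrientation, prodOrientation, ← Module.Basis.orientation_map, prodBasis_map]
    exact orientation_prodBasis
      ((Orientation.someBasis_orientation _ _).trans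
        (hA _ (Orientation.someBasis_orientation _ _)).symm)
      ((Orientation.someBasis_orientation _ _).trans
        (hB _ (Orientation.someBasis_orientation _ _)).symm)
  rw [h, Module.Basis.orientation_map]
  exact (Equiv.injective _).eq_iff.symm

theorem orientation_eq_rayOfNeZero_iff {n : ℕ} {η : V [⋀^Fin n]→ₗ[ℝ] ℝ} (hη : η ≠ 0)
    (b : Module.Basis (Fin n) ℝ V) : b.orientation = rayOfNeZero ℝ η hη ↔ 0 < η b := by
  have h1 := η.eq_smul_basis_det b
  have h2 : η b ≠ 0 := fun h => hη (by rw [h1, h, zero_smul])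
  have h3 : SameRay ℝ b.det η ↔ SameRay ℝ b.det (η b • b.det) := by rw [← h1]
  rw [Module.Basis.orientation, ray_eq_iff, h3, sameRay_smul_right_iff_of_ne b.det_ne_zero h2]

end LinearAlgebra

section ProductOrientation

variable {E : Type*} [NormedAddCommGroup E] [NormedSpace ℝ E] {H : Type*} [TopologicalSpace H]
  {I : ModelWithCorners ℝ E H} {M : Type*} [TopologicalSpace M] [ChartedSpace H M]
  {F : Type*} [NormedAddCommGroup F] [NormedSpace ℝ F] {K : Type*} [TopologicalSpace K]
  {J : ModelWithCorners ℝ F K} {N : Type*} [TopologicalSpace N] [ChartedSpace K N]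
  [IsManifold I ∞ M] [IsManifold J ∞ N]

theorem mfderiv_chart_self (p : M) (u : E) :
    (mfderiv I 𝓘(ℝ, E) (extChartAt I p) p u : E) = u := by
  have : IsManifold I 1 M := .of_le (n := ∞) (by simp)
  exact DFunLike.congr_fun (mfderiv_extChartAt_self (I := I) (x := p)) u

theorem exists_mfderiv_chart_eq {p q : M} (hq : q ∈ (extChartAt I p).source) :
    ∃ A : E ≃ₗ[ℝ] E, ∀ u : E, (mfderiv I 𝓘(ℝ, E) (extChartAt I p) q u : E) = A u := by
  have : IsManifold I 1 M := .of_le (n := ∞) (by simp)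
  obtain ⟨A, hA⟩ := isInvertible_mfderiv_extChartAt hq
  exact ⟨A.toLinearEquiv, fun u => (DFunLike.congr_fun hA u).symm⟩

theorem mfderiv_chart_prod {p q : M × N} (hq : q ∈ (extChartAt (I.prod J) p).source) (u : E × F) :
    (mfderiv (I.prod J) 𝓘(ℝ, E × F) (extChartAt (I.prod J) p) q u : E × F) =
      (mfderiv I 𝓘(ℝ, E) (extChartAt I p.1) q.1 u.1,
        mfderiv J 𝓘(ℝ, F) (extChartAt J p.2) q.2 u.2) := by
  have : IsManifold I 1 M := .of_le (n := ∞) (by simp)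
  have : IsManifold J 1 N := .of_le (n := ∞) (by simp)
  have hd : MDifferentiableAt (I.prod J) 𝓘(ℝ, E × F) (extChartAt (I.prod J) p) q :=
    mdifferentiableAt_extChartAt (by simpa using hq)
  rw [extChartAt_prod, PartialEquiv.prod_source] at hq
  refine Prod.ext ?_ ?_
  · have h1 := mfderiv_comp_apply q ((differentiableAt_fst (𝕜 := ℝ)).mdifferentiableAt) hd u
    have h2 := mfderiv_comp_apply q
      (mdifferentiableAt_extChartAt (I := I) (x := p.1) (by simpa using hq.1))
      (mdifferentiableAt_fst (I := I) (I' := J)) u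
    have he : Prod.fst ∘ extChartAt (I.prod J) p = extChartAt I p.1 ∘ (Prod.fst : M × N → M) := by
      funext z
      rw [Function.comp_apply, extChartAt_prod]
      rfl
    rw [he, h2, mfderiv_fst, mfderiv_eq_fderiv, fderiv_fst] at h1
    exact h1.symm
  · have h1 := mfderiv_comp_apply q ((differentiableAt_snd (𝕜 := ℝ)).mdifferentiableAt) hd u
    have h2 := mfderiv_comp_apply q
      (mdifferentiableAt_extChartAt (I := J) (x := p.2) (by simpa using hq.2))
      (mdifferentiableAt_snd (I := I) (I' := J)) u
    have he : Prod.snd ∘ extChartAt (I.prod J) p = extChartAt J p.2 ∘ (Prod.snd : M × N → N) := by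
      funext z
      rw [Function.comp_apply, extChartAt_prod]
      rfl
    rw [he, h2, mfderiv_snd, mfderiv_eq_fderiv, fderiv_snd] at h1
    exact h1.symm

/-- The product of two oriented surfaces is oriented. -/
def ManifoldOrientation.prod [FiniteDimensional ℝ E] [FiniteDimensional ℝ F]
    (hE : Module.finrank ℝ E = 2) (hF : Module.finrank ℝ F = 2)
    (o : ManifoldOrientation I M 2) (o' : ManifoldOrientation J N 2) :
    ManifoldOrientation (I.prod J) (M × N) 4 where
  at_ p := prodOrientation (V := E) (W := F) hE hF (o.at_ p.1) (o'.at_ p.2)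
  locallyConstant p := by
    filter_upwards [continuousAt_fst.eventually (o.locallyConstant p.1),
      continuousAt_snd.eventually (o'.locallyConstant p.2),
      extChartAt_source_mem_nhds (I := I.prod J) p] with q h1 h2 hq b c hbc
    have hq' := hq
    rw [extChartAt_prod, PartialEquiv.prod_source] at hq'
    obtain ⟨A, hA⟩ := exists_mfderiv_chart_eq (I := I) hq'.1
    obtain ⟨B, hB⟩ := exists_mfderiv_chart_eq (I := J) hq'.2
    let b₀ : Module.Basis (Fin 4) ℝ (E × F) := b
    let c₀ : Module.Basis (Fin 4) ℝ (E × F) := c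
    have hc : c₀ = b₀.map (A.prodCongr B) := by
      refine Module.Basis.eq_of_apply_eq fun i => ?_
      refine (mfderiv_chart_self (I := I.prod J) p (c₀ i)).symm.trans ((hbc i).symm.trans ?_)
      exact (mfderiv_chart_prod hq (b₀ i)).trans (Prod.ext (hA _) (hB _))
    have key := orientation_map_eq_iff (V := E) (W := F) (V' := E) (W' := F) (hV := hE) (hW := hF)
      (hV' := hE) (hW' := hF) (o₁ := o.at_ q.1) (o₂ := o'.at_ q.2) (o₁' := o.at_ p.1)
      (o₂' := o'.at_ p.2) A B
      (fun b' hb' => (h1 b' (b'.map A) fun i =>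
        (hA _).trans (mfderiv_chart_self p.1 (A (b' i))).symm).1 hb')
      (fun b' hb' => (h2 b' (b'.map B) fun i =>
        (hB _).trans (mfderiv_chart_self p.2 (B (b' i))).symm).1 hb') b₀
    rw [← hc] at key
    exact key

end ProductOrientation

section SphereOrientation

open scoped InnerProductSpace

theorem det_ne_zero_of_normal {n : E3} {L : E2 →ₗ[ℝ] E3} (hn : n ≠ 0)
    (hL : Function.Injective L) (ho : ∀ u, ⟪n, L u⟫_ℝ = 0) (b : Module.Basis (Fin 2) ℝ E2) :
    (EuclideanSpace.basisFun (Fin 3) ℝ).toBasis.det ![n, L (b 0), L (b 1)] ≠ 0 := by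
  rw [← isUnit_iff_ne_zero]
  have hli : LinearIndependent ℝ ![n, L (b 0), L (b 1)] := by
    rw [Fintype.linearIndependent_iff]
    intro g hg
    simp only [Fin.sum_univ_three, Matrix.cons_val_zero, Matrix.cons_val_one, Matrix.cons_val] at hg
    have h0 : g 0 = 0 := by
      have := congrArg (fun z => ⟪n, z⟫_ℝ) hg
      simpa [inner_add_right, inner_smul_right, ho, hn] using this
    rw [h0, zero_smul, zero_add, ← L.map_smul, ← L.map_smul, ← L.map_add] at hg
    have h1 := (injective_iff_map_eq_zero L).1 hL _ hg
    have h2 := Fintype.linearIndependent_iff.1 b.linearIndependent ![g 1, g 2]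
      (by simpa [Fin.sum_univ_two] using h1)
    intro i
    fin_cases i
    · exact h0
    · exact h2 0
    · exact h2 1
  refine ((EuclideanSpace.basisFun (Fin 3) ℝ).toBasis.is_basis_iff_det).1 ⟨hli, ?_⟩
  exact hli.span_eq_top_of_card_eq_finrank (by simp)

/-- The area form on the plane `L E2` with normal vector `n`. -/
def areaForm (n : E3) (L : E2 →ₗ[ℝ] E3) : E2 [⋀^Fin 2]→ₗ[ℝ] ℝ :=
  ((EuclideanSpace.basisFun (Fin 3) ℝ).toBasis.det.curryLeft n).compLinearMap L

theorem areaForm_apply (n : E3) (L : E2 →ₗ[ℝ] E3) (w : Fin 2 → E2) :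
    areaForm n L w =
      (EuclideanSpace.basisFun (Fin 3) ℝ).toBasis.det ![n, L (w 0), L (w 1)] := by
  rw [areaForm, AlternatingMap.compLinearMap_apply, AlternatingMap.curryLeft_apply_apply]
  congr 1
  funext i
  fin_cases i <;> rfl

/-- The inclusion of the tangent plane to the sphere. -/
def tangentIncl (p : S2) : E2 →ₗ[ℝ] E3 :=
  (show E2 →L[ℝ] E3 from mfderiv (𝓡 2) 𝓘(ℝ, E3) (Subtype.val : S2 → E3) p).toLinearMap

theorem tangentIncl_eq {p q : S2} (hq : q ∈ (extChartAt (𝓡 2) p).source) (u : E2) :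
    tangentIncl q u = fderiv ℝ (sphereEmb p) (extChartAt (𝓡 2) p q)
      (mfderiv (𝓡 2) 𝓘(ℝ, E2) (extChartAt (𝓡 2) p) q u : E2) := by
  have : IsManifold (𝓡 2) 1 S2 := .of_le (n := ∞) (by simp)
  have he : (Subtype.val : S2 → E3) =ᶠ[𝓝 q] sphereEmb p ∘ extChartAt (𝓡 2) p := by
    filter_upwards [(isOpen_extChartAt_source (I := 𝓡 2) p).mem_nhds hq] with z hz
    rw [Function.comp_apply, sphereEmb, (extChartAt (𝓡 2) p).left_inv hz]
  have hd := (contDiffAt_sphereEmb ((extChartAt (𝓡 2) p).map_source hq)).differentiableAt (by simp)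
  have h1 := mfderiv_comp_apply q hd.mdifferentiableAt
    (mdifferentiableAt_extChartAt (I := 𝓡 2) (x := p) (by simpa using hq)) u
  rw [mfderiv_eq_fderiv, ← he.mfderiv_eq] at h1
  exact h1

theorem inner_fderiv_sphereEmb {p : S2} {y : E2} (hy : y ∈ (extChartAt (𝓡 2) p).target) (u : E2) :
    ⟪sphereEmb p y, fderiv ℝ (sphereEmb p) y u⟫_ℝ = 0 :=
  inner_fderiv_of_norm_eq_one ((contDiffAt_sphereEmb hy).differentiableAt (by simp))
    (.of_forall (norm_sphereEmb p)) u

theorem areaForm_tangentIncl_ne_zero (p : S2) : areaForm p (tangentIncl p) ≠ 0 := by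
  let e : Module.Basis (Fin 2) ℝ E2 := (EuclideanSpace.basisFun (Fin 2) ℝ).toBasis
  intro h0
  have h1 := areaForm_apply p (tangentIncl p) e
  rw [h0, AlternatingMap.zero_apply] at h1
  refine det_ne_zero_of_normal (n := p) (L := tangentIncl p) ?_ (mfderiv_coe_S2_injective p)
    (fun u => ?_) e h1.symm
  · intro h
    simpa [h] using p.2
  · have := inner_fderiv_sphereEmb (mem_extChartAt_target p)
      (mfderiv (𝓡 2) 𝓘(ℝ, E2) (extChartAt (𝓡 2) p) p u)
    rw [tangentIncl_eq (mem_extChartAt_source p)]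
    simpa [sphereEmb] using this

theorem areaForm_tangentIncl {p q : S2} (hq : q ∈ (extChartAt (𝓡 2) p).source)
    (b w : Fin 2 → E2)
    (hw : ∀ i, (mfderiv (𝓡 2) 𝓘(ℝ, E2) (extChartAt (𝓡 2) p) q (b i) : E2) = w i) :
    areaForm q (tangentIncl q) b = areaForm (sphereEmb p (extChartAt (𝓡 2) p q))
      (fderiv ℝ (sphereEmb p) (extChartAt (𝓡 2) p q)).toLinearMap w := by
  rw [areaForm_apply, areaForm_apply, tangentIncl_eq hq, tangentIncl_eq hq, hw, hw, sphereEmb,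
    (extChartAt (𝓡 2) p).left_inv hq]
  rfl

theorem continuous_det_vec3 : Continuous fun z : E3 × E3 × E3 =>
    (EuclideanSpace.basisFun (Fin 3) ℝ).toBasis.det ![z.1, z.2.1, z.2.2] := by
  simp only [Module.Basis.det_apply]
  refine Continuous.matrix_det (continuous_matrix fun i j => ?_)
  simp only [Module.Basis.toMatrix_apply, OrthonormalBasis.coe_toBasis_repr_apply,
    EuclideanSpace.basisFun_repr]
  have hp : Continuous fun v : E3 => v i := (EuclideanSpace.proj (𝕜 := ℝ) i).continuous
  fin_cases j
  · exact hp.comp continuous_fst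
  · exact hp.comp (continuous_fst.comp continuous_snd)
  · exact hp.comp (continuous_snd.comp continuous_snd)

theorem continuousAt_areaForm_sphereEmb (p : S2) (w : Fin 2 → E2) :
    ContinuousAt (fun y => areaForm (sphereEmb p y) (fderiv ℝ (sphereEmb p) y).toLinearMap w)
      (extChartAt (𝓡 2) p p) := by
  have hs := contDiffAt_sphereEmb (mem_extChartAt_target (I := 𝓡 2) p)
  have h0 : ContinuousAt (sphereEmb p) (extChartAt (𝓡 2) p p) := hs.continuousAt
  have h1 : ContinuousAt (fderiv ℝ (sphereEmb p)) (extChartAt (𝓡 2) p p) :=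
    (contDiffAt_fderiv_top hs).continuousAt
  have hw (i) : ContinuousAt (fun y => fderiv ℝ (sphereEmb p) y (w i)) (extChartAt (𝓡 2) p p) :=
    h1.clm_apply continuousAt_const
  have he : (fun y => areaForm (sphereEmb p y) (fderiv ℝ (sphereEmb p) y).toLinearMap w) =
      (fun z : E3 × E3 × E3 =>
        (EuclideanSpace.basisFun (Fin 3) ℝ).toBasis.det ![z.1, z.2.1, z.2.2]) ∘
      fun y => (sphereEmb p y, fderiv ℝ (sphereEmb p) y (w 0), fderiv ℝ (sphereEmb p) y (w 1)) :=
    funext fun y => areaForm_apply _ _ _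
  rw [he]
  exact continuous_det_vec3.continuousAt.comp (h0.prodMk ((hw 0).prodMk (hw 1)))

/-- The orientation of the unit sphere by the outer normal. -/
def sphereOrientation : ManifoldOrientation (𝓡 2) S2 2 where
  at_ p := rayOfNeZero ℝ (M := E2 [⋀^Fin 2]→ₗ[ℝ] ℝ) _ (areaForm_tangentIncl_ne_zero p)
  locallyConstant p := by
    let e : Module.Basis (Fin 2) ℝ E2 := (EuclideanSpace.basisFun (Fin 2) ℝ).toBasis
    set D : E2 → ℝ := fun y =>
      areaForm (sphereEmb p y) (fderiv ℝ (sphereEmb p) y).toLinearMap e with hD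
    have hp := mem_extChartAt_target (I := 𝓡 2) p
    have h0 : D (extChartAt (𝓡 2) p p) ≠ 0 := by
      simp only [hD, areaForm_apply]
      exact det_ne_zero_of_normal (norm_ne_zero_iff.1 (by simp [norm_sphereEmb]))
        (fderiv_sphereEmb_injective hp) (inner_fderiv_sphereEmb hp) e
    have hpos : ∀ᶠ y in 𝓝 (extChartAt (𝓡 2) p p), 0 < D y * D (extChartAt (𝓡 2) p p) :=
      ((continuousAt_areaForm_sphereEmb p e).mul continuousAt_const).eventually
        (lt_mem_nhds (mul_self_pos.2 h0))
    filter_upwards [(continuousAt_extChartAt p).eventually hpos,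
      extChartAt_source_mem_nhds (I := 𝓡 2) p] with q h1 hq b c hbc
    let b₀ : Module.Basis (Fin 2) ℝ E2 := b
    let c₀ : Module.Basis (Fin 2) ℝ E2 := c
    let w : Fin 2 → E2 := fun i => mfderiv (𝓡 2) 𝓘(ℝ, E2) (extChartAt (𝓡 2) p) p (c₀ i)
    have hb := areaForm_tangentIncl hq b₀ w hbc
    have hc := areaForm_tangentIncl (mem_extChartAt_source (I := 𝓡 2) p) c₀ w fun _ => rfl
    rw [AlternatingMap.eq_smul_basis_det e (areaForm (sphereEmb p _) _), AlternatingMap.smul_apply]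
      at hb hc
    have key : b₀.orientation = rayOfNeZero ℝ _ (areaForm_tangentIncl_ne_zero q) ↔
        c₀.orientation = rayOfNeZero ℝ _ (areaForm_tangentIncl_ne_zero p) := by
      rw [orientation_eq_rayOfNeZero_iff, orientation_eq_rayOfNeZero_iff, hb, hc]
      change 0 < D _ * _ ↔ 0 < D _ * _
      rcases mul_pos_iff.1 h1 with h | h
      · rw [mul_pos_iff_of_pos_left h.1, mul_pos_iff_of_pos_left h.2]
      · rw [mul_pos_iff, mul_pos_iff]
        simp only [h.1, h.2, h.1.not_gt, h.2.not_gt, false_and, true_and, false_or]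
    exact key

end SphereOrientation

end RiemGeom

end

theorem mainTheorem10 (γ : ℕ) (_hγ : 2 ≤ γ) (S : Type*) [TopologicalSpace S]
    [ChartedSpace (EuclideanSpace ℝ (Fin 2)) S] [IsManifold (𝓡 2) ∞ S]
    (_hS : RiemGeom.IsClosedOrientableSurface S γ)
    (h : Bundle.ContMDiffRiemannianMetric (𝓡 2) ∞ (EuclideanSpace ℝ (Fin 2))
      (fun x : S => TangentSpace (𝓡 2) x))
    (_hyperbolic : RiemGeom.HasConstCurvOn (𝓡 2) h.inner (-1) Set.univ) :
    -- locally conformally flat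
    RiemGeom.IsLocallyConformallyFlat ((𝓡 2).prod (𝓡 2)) (RiemGeom.productMetric h.inner) ∧
    -- orientable, and self-dual for every orientation
    Nonempty (RiemGeom.ManifoldOrientation ((𝓡 2).prod (𝓡 2)) (RiemGeom.S2 × S) 4) ∧
    (∀ o : RiemGeom.ManifoldOrientation ((𝓡 2).prod (𝓡 2)) (RiemGeom.S2 × S) 4,
      RiemGeom.IsSelfDual (RiemGeom.productMetric h.inner) o) ∧
    -- the curvature tensor
    (∀ (p : RiemGeom.S2 × S) (X Y Z T : TangentSpace ((𝓡 2).prod (𝓡 2)) p),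
      RiemGeom.curvature ((𝓡 2).prod (𝓡 2)) (RiemGeom.productMetric h.inner) p X Y Z T =
        RiemGeom.kulkarniNomizu (fun v w => RiemGeom.productMetric h.inner p v w)
          (fun v w => (RiemGeom.sphereTensor p v w - RiemGeom.surfaceTensor h.inner p v w) / 2)
          X Y Z T) ∧
    -- the Weyl tensor vanishes
    (∀ (p : RiemGeom.S2 × S) (X Y Z T : TangentSpace ((𝓡 2).prod (𝓡 2)) p),
      RiemGeom.weyl ((𝓡 2).prod (𝓡 2)) (RiemGeom.productMetric h.inner) p X Y Z T = 0) := by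
  refine ⟨RiemGeom.isLocallyConformallyFlat_productMetric _hyperbolic, ?_,
    RiemGeom.isSelfDual_productMetric _hyperbolic,
    RiemGeom.curvature_productMetric _hyperbolic, RiemGeom.weyl_productMetric _hyperbolic⟩
  obtain ⟨o⟩ := _hS.orientable
  exact ⟨RiemGeom.sphereOrientation.prod (by simp) (by simp) o⟩
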